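/- Let $\mathcal X$ be the set of continuous functions $x:\mathbb R\to\mathbb R$ with $\lim_{t\to\pm\infty}x(t)=\pm1$, endowed with the metric $d(x,y)=\sup_{t\in\mathbb R}|x(t)-y(t)|$, and let $V(u)=\frac14(u^2-1)^2$. For $\ell>0$ let $\mathcal X_\ell$ be the set of $x\in\mathcal X$ with $x(t)=\operatorname{sgn}(t)$ for all $|t|\ge\ell$, and define $\mathcal F_\ell:\mathcal X\to[0,+\infty]$ by $$\mathcal F_\ell(x)=\int_{-\ell}^{\ell}\Big[\tfrac12\,x'(t)^2+2V(x(t))\Big]\,dt$$ if $x\in\mathcal X_\ell$ and the restriction of $x$ to $(-\ell,\ell)$ belongs to the Sobolev space $W^{1,2}$ (with weak derivative $x'$), and $\mathcal F_\ell(x)=+\infty$ otherwise. For every $\ell>0$ the functional $\mathcal F_\ell$ has a unique minimizer $m^*_\ell$ in $\mathcal X_\ell$. Define the excess free energy $\mathcal G_\ell:\mathcal X\to[0,+\infty]$ by $$\mathcal G_\ell(x)=e^{4\ell}\big[\mathcal F_\ell(x)-\mathcal F_\ell(m^*_\ell)\big],$$ and $\mathcal G:\mathcal X\to[0,+\infty]$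 by $\mathcal G(x)=16\,[\cosh(4z)-1]$ if $x(t)=\tanh(t-z)$ for all $t$, for some $z\in\mathbb R$, and $\mathcal G(x)=+\infty$ otherwise. Then for every sequence $\ell_n>0$ with $\ell_n\to\infty$: 1. (Equi-coercivity) every sequence $x_n\in\mathcal X$ with $\limsup_n\mathcal G_{\ell_n}(x_n)<+\infty$ has a subsequence that converges in $\mathcal X$; 2. ($\Gamma$-convergence) for every $x\in\mathcal X$ there is a sequence $x_n\to x$ in $\mathcal X$ with $\limsup_n\mathcal G_{\ell_n}(x_n)\le\mathcal G(x)$, and for every sequence $x_n\to x$ in $\mathcal X$ one has $\liminf_n\mathcal G_{\ell_n}(x_n)\ge\mathcal G(x)$. -/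

import Mathlib

open Filter Topology MeasureTheory Set
open scoped ENNReal ContDiff BoundedContinuousFunction

noncomputable section

namespace DoubleWell

/-- The space `𝒳` of continuous functions `x : ℝ → ℝ` with `x(t) → ±1` as `t → ±∞`, with the
metric `d(x, y) = sup_t |x(t) - y(t)|`. Such functions are automatically bounded (see
`exists_profile`), so `𝒳` is a subset of the bounded continuous functions, whose metric is the
supremum metric. -/
abbrev Profile : Type :=
  {x : ℝ →ᵇ ℝ // Tendsto x atTop (𝓝 1) ∧ Tendsto x atBot (𝓝 (-1))}

/-- Every continuous function with the prescribed limits at `±∞` is an element of `𝒳`. -/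
theorem exists_profile (f : ℝ → ℝ) (hf : Continuous f) (h1 : Tendsto f atTop (𝓝 1))
    (h2 : Tendsto f atBot (𝓝 (-1))) : ∃ x : Profile, ∀ t, x.1 t = f t := by
  have hb : ∃ C : ℝ, ∀ t, ‖f t‖ ≤ C := by
    have e1 : ∀ᶠ t in atTop, ‖f t‖ < 2 := by
      have := h1.norm.eventually (gt_mem_nhds (show ‖(1 : ℝ)‖ < 2 by norm_num))
      exact this
    have e2 : ∀ᶠ t in atBot, ‖f t‖ < 2 := by
      have := h2.norm.eventually (gt_mem_nhds (show ‖(-1 : ℝ)‖ < 2 by norm_num))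
      exact this
    obtain ⟨b, hb⟩ := eventually_atTop.1 e1
    obtain ⟨a, ha⟩ := eventually_atBot.1 e2
    obtain ⟨C, hC⟩ := (isCompact_Icc (a := a) (b := b)).exists_bound_of_continuousOn
      hf.continuousOn
    refine ⟨max C 2, fun t => ?_⟩
    by_cases hta : t ≤ a
    · exact (ha t hta).le.trans (le_max_right _ _)
    by_cases htb : b ≤ t
    · exact (hb t htb).le.trans (le_max_right _ _)
    · exact (hC t ⟨(not_le.1 hta).le, (not_le.1 htb).le⟩).trans (le_max_left _ _)
  obtain ⟨C, hC⟩ := hb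
  exact ⟨⟨BoundedContinuousFunction.ofNormedAddCommGroup f hf C hC, h1, h2⟩, fun _ => rfl⟩

/-- The symmetric double well potential. -/
def potential (u : ℝ) : ℝ := (1 / 4) * (u ^ 2 - 1) ^ 2

/-- The set `𝒳_ℓ` of the profiles with `x(t) = sgn(t)` for `|t| ≥ ℓ`. -/
def boundarySet (ℓ : ℝ) : Set Profile := {x | ∀ t : ℝ, ℓ ≤ |t| → x.1 t = Real.sign t}

/-- `g ∈ L²(a, b)` is the weak derivative of `u` on the open interval `(a, b)`. -/
def IsWeakDeriv (a b : ℝ) (u g : ℝ → ℝ) : Prop :=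
  MemLp g 2 (volume.restrict (Ioo a b)) ∧
    ∀ φ : ℝ → ℝ, ContDiff ℝ ∞ φ → HasCompactSupport φ → tsupport φ ⊆ Ioo a b →
      ∫ t in Ioo a b, u t * deriv φ t = - ∫ t in Ioo a b, g t * φ t

/-- The weak derivative is unique almost everywhere on `(a, b)`. -/
theorem IsWeakDeriv.ae_eq {a b : ℝ} {u g h : ℝ → ℝ} (hg : IsWeakDeriv a b u g)
    (hh : IsWeakDeriv a b u h) : g =ᵐ[volume.restrict (Ioo a b)] h := by
  have ig : IntegrableOn g (Ioo a b) := hg.1.integrable (by norm_num)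
  have ih : IntegrableOn h (Ioo a b) := hh.1.integrable (by norm_num)
  have key := isOpen_Ioo.ae_eq_zero_of_integral_contDiff_smul_eq_zero (μ := volume)
    (U := Ioo a b) (f := fun t => g t - h t) (ig.sub ih).locallyIntegrableOn ?_
  · rw [Filter.EventuallyEq, ae_restrict_iff' measurableSet_Ioo]
    filter_upwards [key] with t ht hm
    exact sub_eq_zero.1 (ht hm)
  · intro φ h1 h2 h3
    obtain ⟨C, hC⟩ := h2.exists_bound_of_continuous h1.continuous
    have bd : ∀ f : ℝ → ℝ, IntegrableOn f (Ioo a b) →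
        IntegrableOn (fun t => f t * φ t) (Ioo a b) := fun f hf =>
      Integrable.mul_bdd (c := C) hf h1.continuous.aestronglyMeasurable (Eventually.of_forall hC)
    have e : ∫ t in Ioo a b, (g t * φ t - h t * φ t) = 0 := by
      rw [integral_sub (bd g ig) (bd h ih)]
      have := (hg.2 φ h1 h2 h3).symm.trans (hh.2 φ h1 h2 h3)
      linarith
    rw [← e, ← setIntegral_eq_integral_of_forall_compl_eq_zero (s := Ioo a b)]
    · congr 1
      ext t
      simp only [smul_eq_mul]
      ring
    · intro t ht
      rw [image_eq_zero_of_notMem_tsupport (fun hc => ht (h3 hc)), zero_smul]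

/-- The restriction of `u` to `(a, b)` belongs to the Sobolev space `W^{1,2}`. -/
def MemW12 (a b : ℝ) (u : ℝ → ℝ) : Prop :=
  MemLp u 2 (volume.restrict (Ioo a b)) ∧ ∃ g, IsWeakDeriv a b u g

open Classical in
/-- The weak derivative of a function in `W^{1,2}(a, b)`. -/
def weakDeriv (a b : ℝ) (u : ℝ → ℝ) : ℝ → ℝ :=
  if h : ∃ g, IsWeakDeriv a b u g then h.choose else 0

open Classical in
/-- The finite volume free energy `ℱ_ℓ : 𝒳 → [0, ∞]`. -/
def freeEnergy (ℓ : ℝ) (x : Profile) : ℝ≥0∞ :=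
  if x ∈ boundarySet ℓ ∧ MemW12 (-ℓ) ℓ x.1 then
    ∫⁻ t in Ioo (-ℓ) ℓ,
      ENNReal.ofReal ((1 / 2) * (weakDeriv (-ℓ) ℓ x.1 t) ^ 2 + 2 * potential (x.1 t))
  else ⊤

/-- `m` is a minimizer of `ℱ_ℓ` in `𝒳_ℓ`. -/
def IsMinimizer (ℓ : ℝ) (m : Profile) : Prop :=
  m ∈ boundarySet ℓ ∧ ∀ x ∈ boundarySet ℓ, freeEnergy ℓ m ≤ freeEnergy ℓ x

/-- The excess free energy `e^{4ℓ} [ℱ_ℓ(x) - ℱ_ℓ(m)]`, to be used with `m` a minimizer of `ℱ_ℓ`,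
so that the difference is a nonnegative extended real number. -/
def excessFreeEnergy (ℓ : ℝ) (m x : Profile) : ℝ≥0∞ :=
  ENNReal.ofReal (Real.exp (4 * ℓ)) * (freeEnergy ℓ x - freeEnergy ℓ m)

/-- `x` is the translate `t ↦ th(t - z)`. -/
def IsTranslate (z : ℝ) (x : Profile) : Prop := ∀ t, x.1 t = Real.tanh (t - z)

open Classical in
/-- The limiting functional: `16 [ch(4z) - 1]` at `th(· - z)`, and `∞` at all other profiles. -/
def limitFunctional (x : Profile) : ℝ≥0∞ :=
  if h : ∃ z, IsTranslate z x then ENNReal.ofReal (16 * (Real.cosh (4 * h.choose) - 1)) else ⊤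

/-- The value of the limiting functional at `th(· - z)`. -/
theorem limitFunctional_eq {z : ℝ} {x : Profile} (h : IsTranslate z x) :
    limitFunctional x = ENNReal.ofReal (16 * (Real.cosh (4 * z) - 1)) := by
  have hx : ∃ z, IsTranslate z x := ⟨z, h⟩
  have hz : hx.choose = z := by
    have e := Real.tanh_injective ((hx.choose_spec 0).symm.trans (h 0))
    linarith
  rw [limitFunctional, dif_pos hx, hz]

/-- Equi-coercivity: every sequence with bounded `limsup` has a converging subsequence. -/
def EquiCoercive {X : Type*} [TopologicalSpace X] (F : ℕ → X → ℝ≥0∞) : Prop :=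
  ∀ x : ℕ → X, limsup (fun n => F n (x n)) atTop < ⊤ →
    ∃ (a : X) (k : ℕ → ℕ), StrictMono k ∧ Tendsto (fun j => x (k j)) atTop (𝓝 a)

/-- `Γ`-convergence of a sequence of functionals on a metric space. -/
def GammaConverges {X : Type*} [MetricSpace X] (F : ℕ → X → ℝ≥0∞) (G : X → ℝ≥0∞) : Prop :=
  ∀ a : X,
    (∃ x : ℕ → X, Tendsto x atTop (𝓝 a) ∧ limsup (fun n => F n (x n)) atTop ≤ G a) ∧
    ∀ x : ℕ → X, Tendsto x atTop (𝓝 a) → G a ≤ liminf (fun n => F n (x n)) atTop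

end DoubleWell

end

/-! Since `2V(u) = (1 - u²)²/2`, completing the square in the free energy (the Modica–Mortola
identity) leaves a boundary term, which on `𝒳_ℓ` is always `4/3`, plus half of `defect`, the squared
`L²` norm of `f = x' - (1 - x²)` on `(-ℓ, ℓ)`. So the excess energy is a difference of two
quantities `e^{4ℓ} defect / 2`, and it suffices to find the asymptotics of this quantity.

Lower bound. A profile in `𝒳_ℓ` has a zero `z`. To the right of `z` the deviation `y = x - tanh(· -
z)` solves `y' + (x + tanh(· - z)) y = f` with `y(z) = 0`, and it must reach `1 - tanh R` at
distance `R = ℓ - z`. A bootstrap argument keeps `x` close to `tanh(· - z)`, so the Duhamel kernel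
is nearly `cosh² s / cosh² R`, whose squared `L²` norm is nearly `1/4`. By Cauchy–Schwarz this side
has defect at least about `4 (1 - tanh R)² ≈ 16 e^{-4R}`. A reflection gives the left side, with `R
= ℓ + z`. The sum, multiplied by `e^{4ℓ}/2`, is `16 cosh(4z)` (`IsSobolev.estimate`). Hence bounded
excess confines the zeros to a compact set, and the profiles subconverge to a translate of `tanh`
(`exists_subseq_tendsto`).

Upper bound. Adding to `tanh(· - z)` a solution of `y'' = 4y` that corrects the values at `±ℓ`
attains `16 cosh(4z)` asymptotically (`exists_recovery`). The case `z = 0` and the lower bound show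
that the minimal cost tends to `16` (`tendsto_minimal_defect`), with no asymptotic analysis of the
minimizer. Subtraction gives `16 (cosh(4z) - 1)`.

Existence and uniqueness of the minimizer come from a different calibration, by the first order
equation `m' = √((1 - m²)² + c)`, with `c` fixed by the boundary values. -/

namespace DoubleWell

/-! ### Calculus of absolutely continuous functions -/

/-- `u` is a primitive of the integrable function `g` on `[a, b]`. -/
structure IsPrim (a b : ℝ) (u g : ℝ → ℝ) : Prop where
  intervalIntegrable : IntervalIntegrable g volume a b
  eq_add_integral : ∀ t ∈ Icc a b, u t = u a + ∫ s in a..t, g s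

theorem _root_.AbsolutelyContinuousOnInterval.congr_on {u v : ℝ → ℝ} {a b : ℝ}
    (hu : AbsolutelyContinuousOnInterval u a b) (h : EqOn u v (uIcc a b)) :
    AbsolutelyContinuousOnInterval v a b := by
  rw [absolutelyContinuousOnInterval_iff] at hu ⊢
  intro ε hε
  obtain ⟨δ, hδ, H⟩ := hu ε hε
  refine ⟨δ, hδ, fun E hE hs => ?_⟩
  convert H E hE hs using 1
  refine Finset.sum_congr rfl fun i hi => ?_
  rw [h (hE.1 i hi).1, h (hE.1 i hi).2]

/-- The Lipschitz bound is asked only along the values of `u`, because in `IsPrim.comp` the outer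
function is `C¹` and hence only locally Lipschitz. -/
theorem _root_.AbsolutelyContinuousOnInterval.lipschitz_comp {u P : ℝ → ℝ} {a b K : ℝ}
    (hu : AbsolutelyContinuousOnInterval u a b) (hK : 0 ≤ K)
    (h : ∀ s ∈ uIcc a b, ∀ t ∈ uIcc a b, dist (P (u s)) (P (u t)) ≤ K * dist (u s) (u t)) :
    AbsolutelyContinuousOnInterval (fun t => P (u t)) a b := by
  rw [absolutelyContinuousOnInterval_iff] at hu ⊢
  intro ε hε
  -- Dividing by `K + 1` covers the case `K = 0`.
  obtain ⟨δ, hδ, H⟩ := hu (ε / (K + 1)) (by positivity)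
  refine ⟨δ, hδ, fun E hE hs => ?_⟩
  have h1 := H E hE hs
  calc ∑ i ∈ Finset.range E.1, dist (P (u (E.2 i).1)) (P (u (E.2 i).2))
      ≤ ∑ i ∈ Finset.range E.1, K * dist (u (E.2 i).1) (u (E.2 i).2) :=
        Finset.sum_le_sum fun i hi => h _ (hE.1 i hi).1 _ (hE.1 i hi).2
    _ = K * ∑ i ∈ Finset.range E.1, dist (u (E.2 i).1) (u (E.2 i).2) := by rw [Finset.mul_sum]
    _ ≤ K * (ε / (K + 1)) := by gcongr
    _ < (K + 1) * (ε / (K + 1)) := by gcongr; linarith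
    _ = ε := by field_simp

namespace IsPrim

variable {a b : ℝ} {u v g k : ℝ → ℝ}

theorem absolutelyContinuous (hu : IsPrim a b u g) (hab : a ≤ b) :
    AbsolutelyContinuousOnInterval u a b := by
  have h := hu.intervalIntegrable.absolutelyContinuousOnInterval_intervalIntegral
    (c := a) left_mem_uIcc
  have hc : AbsolutelyContinuousOnInterval (fun _ : ℝ => u a) a b :=
    contDiffOn_const.absolutelyContinuousOnInterval
  refine (hc.fun_add h).congr_on fun t ht => ?_
  rw [uIcc_of_le hab] at ht
  exact (hu.eq_add_integral t ht).symm

theorem continuousOn (hu : IsPrim a b u g) (hab : a ≤ b) : ContinuousOn u (Icc a b) := by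
  rw [← uIcc_of_le hab]
  exact (hu.absolutelyContinuous hab).continuousOn

theorem ae_hasDerivAt (hu : IsPrim a b u g) (hab : a ≤ b) :
    ∀ᵐ t, t ∈ Ioo a b → HasDerivAt u (g t) t := by
  filter_upwards [hu.intervalIntegrable.ae_hasDerivAt_integral] with t ht hm
  have h1 := ht (by rw [uIcc_of_le hab]; exact Ioo_subset_Icc_self hm) a left_mem_uIcc
  refine (h1.const_add (u a)).congr_of_eventuallyEq ?_
  filter_upwards [Ioo_mem_nhds hm.1 hm.2] with s hs
  exact hu.eq_add_integral s (Ioo_subset_Icc_self hs)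

/-- An absolutely continuous function is recovered from its a.e. derivative. With `ae_hasDerivAt`
this reduces the rules for differences, products and compositions to the pointwise ones. -/
theorem of_ae_hasDerivAt (hab : a ≤ b) (hu : AbsolutelyContinuousOnInterval u a b)
    (h : ∀ᵐ t, t ∈ Ioo a b → HasDerivAt u (g t) t) : IsPrim a b u g := by
  have e : ∀ᵐ t, t ∈ Ioc a b → deriv u t = g t := by
    have hb : ∀ᵐ t : ℝ, t ≠ b := by simp [ae_iff, measure_singleton]
    filter_upwards [h, hb] with t ht hb hm
    exact (ht ⟨hm.1, lt_of_le_of_ne hm.2 hb⟩).deriv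
  have hi := hu.intervalIntegrable_deriv
  refine ⟨?_, fun t ht => ?_⟩
  · refine hi.congr_ae ?_
    rw [uIoc_of_le hab]
    exact (ae_restrict_iff' measurableSet_Ioc).2 e
  · have h1 := (hu.mono (c := a) (d := t) (by
      rw [uIcc_of_le hab, uIcc_of_le ht.1]; exact Icc_subset_Icc_right ht.2)).integral_deriv_eq_sub
    have h2 : ∫ s in a..t, deriv u s = ∫ s in a..t, g s := by
      refine intervalIntegral.integral_congr_ae ?_
      filter_upwards [e] with s hs hm
      rw [uIoc_of_le ht.1] at hm
      exact hs ⟨hm.1, hm.2.trans ht.2⟩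
    linarith

theorem of_hasDerivAt (hu : ∀ t, HasDerivAt u (g t) t) (hg : Continuous g) :
    IsPrim a b u g where
  intervalIntegrable := hg.intervalIntegrable _ _
  eq_add_integral t _ := by
    rw [intervalIntegral.integral_eq_sub_of_hasDerivAt (fun s _ => hu s)
      (hg.intervalIntegrable _ _)]
    ring

theorem integral_eq_sub (hu : IsPrim a b u g) (hab : a ≤ b) : ∫ t in a..b, g t = u b - u a := by
  have := hu.eq_add_integral b (right_mem_Icc.2 hab)
  linarith

theorem mono {c d : ℝ} (hu : IsPrim a b u g) (hac : a ≤ c) (hcd : c ≤ d) (hdb : d ≤ b) :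
    IsPrim c d u g := by
  have hI : IntervalIntegrable g volume c d := hu.intervalIntegrable.mono_set (by
    rw [uIcc_of_le hcd, uIcc_of_le (hac.trans (hcd.trans hdb))]; exact Icc_subset_Icc hac hdb)
  have hI' : IntervalIntegrable g volume a c := hu.intervalIntegrable.mono_set (by
    rw [uIcc_of_le hac, uIcc_of_le (hac.trans (hcd.trans hdb))]
    exact Icc_subset_Icc_right (hcd.trans hdb))
  refine ⟨hI, fun t ht => ?_⟩
  rw [hu.eq_add_integral t ⟨hac.trans ht.1, ht.2.trans hdb⟩,
    hu.eq_add_integral c ⟨hac, hcd.trans hdb⟩, add_assoc,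
    intervalIntegral.integral_add_adjacent_intervals hI' (hI.mono_set (by
      rw [uIcc_of_le hcd, uIcc_of_le ht.1]; exact Icc_subset_Icc_right ht.2))]

theorem sub (hu : IsPrim a b u g) (hv : IsPrim a b v k) (hab : a ≤ b) :
    IsPrim a b (fun t => u t - v t) (fun t => g t - k t) := by
  refine of_ae_hasDerivAt hab
    ((hu.absolutelyContinuous hab).fun_sub (hv.absolutelyContinuous hab)) ?_
  filter_upwards [hu.ae_hasDerivAt hab, hv.ae_hasDerivAt hab] with t h1 h2 hm
  exact (h1 hm).sub (h2 hm)

theorem mul (hu : IsPrim a b u g) (hv : IsPrim a b v k) (hab : a ≤ b) :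
    IsPrim a b (fun t => u t * v t) (fun t => g t * v t + u t * k t) := by
  refine of_ae_hasDerivAt hab
    ((hu.absolutelyContinuous hab).fun_mul (hv.absolutelyContinuous hab)) ?_
  filter_upwards [hu.ae_hasDerivAt hab, hv.ae_hasDerivAt hab] with t h1 h2 hm
  exact (h1 hm).mul (h2 hm)

theorem comp {P p : ℝ → ℝ} (hu : IsPrim a b u g) (hab : a ≤ b)
    (hP : ∀ y, HasDerivAt P (p y) y) (hp : Continuous p) :
    IsPrim a b (fun t => P (u t)) (fun t => p (u t) * g t) := by
  have hc := hu.continuousOn hab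
  obtain ⟨C, hC⟩ := isCompact_Icc.exists_bound_of_continuousOn hc
  obtain ⟨K, hK⟩ := (isCompact_Icc (a := -C) (b := C)).exists_bound_of_continuousOn
    hp.continuousOn
  have hm : ∀ s ∈ uIcc a b, u s ∈ Icc (-C) C := fun s hs => by
    rw [uIcc_of_le hab] at hs
    exact abs_le.1 (hC s hs)
  refine of_ae_hasDerivAt hab
    ((hu.absolutelyContinuous hab).lipschitz_comp (P := P) (K := |K|) (abs_nonneg _) ?_) ?_
  · intro s hs t ht
    have := (convex_Icc (-C) C).norm_image_sub_le_of_norm_hasDerivWithin_le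
      (fun y _ => (hP y).hasDerivWithinAt) (fun y hy => (hK y hy).trans (le_abs_self K))
      (hm t ht) (hm s hs)
    simpa [dist_eq_norm] using this
  · filter_upwards [hu.ae_hasDerivAt hab] with t h1 hm
    exact (hP _).comp t (h1 hm)

theorem comp_add_left {L : ℝ} (c : ℝ) (hu : IsPrim (c + 0) (c + L) u g) :
    IsPrim 0 L (fun t => u (c + t)) (fun t => g (c + t)) := by
  refine ⟨by simpa using hu.intervalIntegrable.comp_add_left c, fun t ht => ?_⟩
  rw [intervalIntegral.integral_comp_add_left (fun s => g s) c,
    hu.eq_add_integral (c + t) ⟨by linarith [ht.1], by linarith [ht.2]⟩]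

/-- The reflection `t ↦ -u(c - t)` preserves the equation `u' = 1 - u²`, so estimates to the right
of a zero also serve to its left. -/
theorem neg_comp_sub_left {L : ℝ} (c : ℝ) (hu : IsPrim (c - L) (c - 0) u g) :
    IsPrim 0 L (fun t => -u (c - t)) (fun t => g (c - t)) := by
  have hI := hu.intervalIntegrable
  refine ⟨by simpa using (hI.comp_sub_left c).symm, fun t ht => ?_⟩
  rw [intervalIntegral.integral_comp_sub_left (fun s => g s) c]
  have h1 := (hu.mono (c := c - t) (by linarith [ht.2]) (by linarith [ht.1]) le_rfl).integral_eq_sub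
    (by linarith [ht.1])
  linarith

end IsPrim

/-! ### Weak derivatives of continuous functions are absolutely continuous derivatives -/

theorem integral_Ioo_eq_interval {a b : ℝ} (hab : a ≤ b) (f : ℝ → ℝ) :
    ∫ t in Ioo a b, f t = ∫ t in a..b, f t := by
  rw [intervalIntegral.integral_of_le hab, integral_Ioc_eq_integral_Ioo]

theorem eq_zero_of_tsupport_subset_Ioo {a b t : ℝ} {φ : ℝ → ℝ} (h : tsupport φ ⊆ Ioo a b)
    (ht : t ∉ Ioo a b) : φ t = 0 :=
  image_eq_zero_of_notMem_tsupport fun hc => ht (h hc)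

theorem IsPrim.integral_mul_deriv_test {a b : ℝ} {u g φ : ℝ → ℝ} (hab : a ≤ b)
    (hu : IsPrim a b u g) (h1 : ContDiff ℝ ∞ φ) (h3 : tsupport φ ⊆ Ioo a b) :
    ∫ t in a..b, u t * deriv φ t = - ∫ t in a..b, g t * φ t := by
  have hd : Continuous (deriv φ) := h1.continuous_deriv (by simp)
  have hφ : IsPrim a b φ (deriv φ) := IsPrim.of_hasDerivAt
    (fun t => (h1.differentiable (by simp) t).hasDerivAt) hd
  have h := (hu.mul hφ hab).integral_eq_sub hab
  have ea := eq_zero_of_tsupport_subset_Ioo (t := a) h3 (by simp)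
  have eb := eq_zero_of_tsupport_subset_Ioo (t := b) h3 (by simp)
  rw [intervalIntegral.integral_add] at h
  · simp only [ea, eb] at h
    linarith
  · exact hu.intervalIntegrable.mul_continuousOn h1.continuous.continuousOn
  · refine ContinuousOn.intervalIntegrable ?_
    rw [uIcc_of_le hab]
    exact (hu.continuousOn hab).mul hd.continuousOn

theorem IsPrim.isWeakDeriv {a b : ℝ} {u g : ℝ → ℝ} (hab : a ≤ b)
    (hu : IsPrim a b u g) (hg : MemLp g 2 (volume.restrict (Ioo a b))) :
    IsWeakDeriv a b u g := by
  refine ⟨hg, fun φ h1 _ h3 => ?_⟩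
  rw [integral_Ioo_eq_interval hab, integral_Ioo_eq_interval hab]
  exact hu.integral_mul_deriv_test hab h1 h3

/-- A smooth function of zero mean with support in `(a, b)` is the derivative of a smooth function
with support in `(a, b)`. -/
theorem exists_primitive_of_integral_eq_zero {a b : ℝ} {θ : ℝ → ℝ} (hab : a < b)
    (h1 : ContDiff ℝ ∞ θ) (h3 : tsupport θ ⊆ Ioo a b) (h0 : ∫ t in a..b, θ t = 0) :
    ∃ φ : ℝ → ℝ, ContDiff ℝ ∞ φ ∧ HasCompactSupport φ ∧ tsupport φ ⊆ Ioo a b ∧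
      deriv φ = θ := by
  have hc : IsCompact (tsupport θ) :=
    isCompact_Icc.of_isClosed_subset (isClosed_tsupport θ) (h3.trans Ioo_subset_Icc_self)
  obtain ⟨a', b', ha, hb, hs⟩ : ∃ a' b', a < a' ∧ b' < b ∧ tsupport θ ⊆ Icc a' b' := by
    rcases (tsupport θ).eq_empty_or_nonempty with he | hne
    -- For empty support the endpoints in reverse order make `Icc a' b'` empty.
    · exact ⟨b, a, hab, hab, by simp [he]⟩
    · obtain ⟨c, hc1, hc2⟩ := hc.exists_isLeast hne
      obtain ⟨d, hd1, hd2⟩ := hc.exists_isGreatest hne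
      exact ⟨c, d, (h3 hc1).1, (h3 hd1).2, fun t ht => ⟨hc2 ht, hd2 ht⟩⟩
  have hz : ∀ t, t ∉ Icc a' b' → θ t = 0 := fun t ht =>
    image_eq_zero_of_notMem_tsupport fun hc => ht (hs hc)
  have hder : ∀ t, HasDerivAt (fun t => ∫ s in a..t, θ s) (θ t) t := fun t =>
    intervalIntegral.integral_hasDerivAt_right (h1.continuous.intervalIntegrable _ _)
      (h1.continuous.stronglyMeasurableAtFilter _ _) h1.continuous.continuousAt
  have hderiv : deriv (fun t => ∫ s in a..t, θ s) = θ := funext fun t => (hder t).deriv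
  have hsupp : tsupport (fun t => ∫ s in a..t, θ s) ⊆ Icc a' b' := by
    refine closure_minimal (fun t ht => ?_) isClosed_Icc
    by_contra hn
    refine ht ?_
    have hn' : t < a' ∨ b' < t := by
      by_contra! h
      exact hn h
    rcases hn' with h | h
    · refine intervalIntegral.integral_zero_ae (Eventually.of_forall fun s hs' => hz s fun hm => ?_)
      have : s ≤ max a t := hs'.2
      have := hm.1
      rcases le_max_iff.1 ‹s ≤ max a t› with h' | h' <;> linarith
    -- To the right of the support the primitive equals the full integral, which is zero by `h0`.
    · have e : ∫ s in t..b, θ s = 0 := by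
        refine intervalIntegral.integral_zero_ae
          (Eventually.of_forall fun s hs' => hz s fun hm => ?_)
        have h5 : min t b < s := hs'.1
        have := hm.2
        rcases min_lt_iff.1 h5 with h' | h' <;> linarith
      have := intervalIntegral.integral_add_adjacent_intervals
        (h1.continuous.intervalIntegrable (μ := volume) a t)
        (h1.continuous.intervalIntegrable (μ := volume) t b)
      simp only
      linarith
  refine ⟨fun t => ∫ s in a..t, θ s, ?_, ?_, ?_, hderiv⟩
  · rw [contDiff_infty_iff_deriv]
    exact ⟨fun t => (hder t).differentiableAt, by rw [hderiv]; exact h1⟩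
  · exact isCompact_Icc.of_isClosed_subset (isClosed_tsupport _) hsupp
  · exact hsupp.trans fun t ht => ⟨ha.trans_le ht.1, ht.2.trans_lt hb⟩

theorem exists_test_integral_eq_one {a b : ℝ} (hab : a < b) :
    ∃ ψ : ℝ → ℝ, ContDiff ℝ ∞ ψ ∧ HasCompactSupport ψ ∧ tsupport ψ ⊆ Ioo a b ∧
      ∫ t in a..b, ψ t = 1 := by
  have hr : 0 < (b - a) / 8 := by linarith
  let f : ContDiffBump ((a + b) / 2) := ⟨(b - a) / 8, (b - a) / 4, hr, by linarith⟩
  have hs : tsupport (f.normed volume) ⊆ Ioo a b := by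
    rw [f.tsupport_normed_eq, Real.closedBall_eq_Icc]
    intro t ht
    have h1 := ht.1
    have h2 := ht.2
    simp only [f] at h1 h2
    constructor <;> linarith
  refine ⟨f.normed volume, f.contDiff_normed, f.hasCompactSupport_normed, hs, ?_⟩
  rw [intervalIntegral.integral_eq_integral_of_support_subset, f.integral_normed]
  exact (subset_tsupport _).trans (hs.trans Ioo_subset_Ioc_self)

/-- A continuous function whose weak derivative vanishes is constant. -/
theorem eq_of_weakDeriv_eq_zero {a b : ℝ} {v : ℝ → ℝ} (hab : a < b)
    (hv : ContinuousOn v (Icc a b))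
    (h : ∀ φ : ℝ → ℝ, ContDiff ℝ ∞ φ → HasCompactSupport φ → tsupport φ ⊆ Ioo a b →
      ∫ t in a..b, v t * deriv φ t = 0) : ∀ t ∈ Icc a b, v t = v a := by
  obtain ⟨ψ, p1, p2, p3, p4⟩ := exists_test_integral_eq_one hab
  have hi : ∀ φ : ℝ → ℝ, Continuous φ → IntervalIntegrable (fun t => v t * φ t) volume a b :=
    fun φ hφ => ContinuousOn.intervalIntegrable (by
      rw [uIcc_of_le hab.le]; exact hv.mul hφ.continuousOn)
  -- Du Bois-Reymond: `θ - (∫ θ) ψ` has zero mean, hence is the derivative of a test function, so `∫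
  -- v θ = C ∫ θ` for every test function `θ`. Thus `v = C` almost everywhere, and everywhere by
  -- continuity.
  set C := ∫ t in a..b, v t * ψ t with hC
  have key : ∀ᵐ t, t ∈ Ioo a b → v t - C = 0 := by
    refine isOpen_Ioo.ae_eq_zero_of_integral_contDiff_smul_eq_zero (μ := volume)
      (U := Ioo a b) (f := fun t => v t - C) ?_ ?_
    · exact ((hv.mono Ioo_subset_Icc_self).sub continuousOn_const).locallyIntegrableOn
        measurableSet_Ioo
    · intro θ h1 h2 h3
      set c := ∫ t in a..b, θ t with hc
      have hs : tsupport (fun t => θ t - c * ψ t) ⊆ Ioo a b := by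
        refine (tsupport_sub _ _).trans (union_subset h3 ?_)
        exact (tsupport_mul_subset_right).trans p3
      obtain ⟨φ, f1, f2, f3, f4⟩ := exists_primitive_of_integral_eq_zero hab
        (h1.sub (contDiff_const.mul p1) : ContDiff ℝ ∞ fun t => θ t - c * ψ t) hs (by
          rw [intervalIntegral.integral_sub (h1.continuous.intervalIntegrable _ _)
            ((p1.continuous.intervalIntegrable _ _).const_mul c),
            intervalIntegral.integral_const_mul, p4, mul_one, sub_self])
      have h5 := h φ f1 f2 f3
      have h6 : ∫ t in a..b, v t * deriv φ t = (∫ t in a..b, v t * θ t) - c * C := by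
        rw [f4, hC, ← intervalIntegral.integral_const_mul, ← intervalIntegral.integral_sub
          (hi θ h1.continuous) ((hi ψ p1.continuous).const_mul c)]
        refine intervalIntegral.integral_congr fun t _ => ?_
        ring
      rw [← setIntegral_eq_integral_of_forall_compl_eq_zero (s := Ioo a b),
        integral_Ioo_eq_interval hab.le]
      · have h7 : ∫ t in a..b, θ t • (v t - C) = (∫ t in a..b, v t * θ t) - C * c := by
          rw [hc, ← intervalIntegral.integral_const_mul, ← intervalIntegral.integral_sub
            (hi θ h1.continuous) ((h1.continuous.intervalIntegrable _ _).const_mul C)]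
          refine intervalIntegral.integral_congr fun t _ => ?_
          simp only [smul_eq_mul]
          ring
        rw [h7]
        linarith
      · intro t ht
        rw [eq_zero_of_tsupport_subset_Ioo h3 ht, zero_smul]
  have hIoo : EqOn v (fun _ => C) (Ioo a b) := by
    refine Measure.eqOn_open_of_ae_eq (μ := volume) ?_ isOpen_Ioo (hv.mono Ioo_subset_Icc_self)
      continuousOn_const
    rw [Filter.EventuallyEq, ae_restrict_iff' measurableSet_Ioo]
    filter_upwards [key] with t ht hm
    exact sub_eq_zero.1 (ht hm)
  have hIcc : EqOn v (fun _ => C) (Icc a b) :=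
    hIoo.of_subset_closure hv continuousOn_const Ioo_subset_Icc_self
      (by rw [closure_Ioo hab.ne])
  intro t ht
  rw [hIcc ht, hIcc (left_mem_Icc.2 hab.le)]

/-- The difference between `u` and the primitive of `g` has zero weak derivative, so it is constant.
With `IsPrim.isWeakDeriv` this replaces the Sobolev space by primitives of `L²` functions. -/
theorem IsWeakDeriv.isPrim {a b : ℝ} {u g : ℝ → ℝ} (hab : a < b) (hu : ContinuousOn u (Icc a b))
    (h : IsWeakDeriv a b u g) : IsPrim a b u g := by
  have hI : IntervalIntegrable g volume a b := by
    rw [intervalIntegrable_iff_integrableOn_Ioo_of_le hab.le]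
    exact h.1.integrable (by norm_num)
  have hG : IsPrim a b (fun t => ∫ s in a..t, g s) g := ⟨hI, fun t _ => by simp⟩
  have hGc := hG.continuousOn hab.le
  refine ⟨hI, fun t ht => ?_⟩
  have := eq_of_weakDeriv_eq_zero hab (hu.sub hGc) (fun φ h1 h2 h3 => ?_) t ht
  · simp only [Pi.sub_apply, intervalIntegral.integral_same] at this
    linarith
  · have hd : Continuous (deriv φ) := h1.continuous_deriv (by simp)
    have hi : ∀ v : ℝ → ℝ, ContinuousOn v (Icc a b) →
        IntervalIntegrable (fun t => v t * deriv φ t) volume a b :=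
      fun v hv => ContinuousOn.intervalIntegrable (by
        rw [uIcc_of_le hab.le]; exact hv.mul hd.continuousOn)
    have e1 := h.2 φ h1 h2 h3
    rw [integral_Ioo_eq_interval hab.le, integral_Ioo_eq_interval hab.le] at e1
    have e2 := hG.integral_mul_deriv_test hab.le h1 h3
    simp only [Pi.sub_apply, sub_mul]
    rw [intervalIntegral.integral_sub (hi u hu) (hi _ hGc), e1, e2, sub_self]

/-! ### The free energy as a boundary term plus a square -/

/-- The squared `L²` norm of the defect in the first order equation `u' = 1 - u²`. -/
noncomputable def defect (a b : ℝ) (u g : ℝ → ℝ) : ℝ := ∫ t in a..b, (g t - (1 - u t ^ 2)) ^ 2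

/-- `g ∈ L²(a, b)` and `u` is a primitive of `g` on `[a, b]`. -/
structure IsSobolev (a b : ℝ) (u g : ℝ → ℝ) : Prop where
  isPrim : IsPrim a b u g
  sq_integrable : IntervalIntegrable (fun t => g t ^ 2) volume a b

namespace IsSobolev

variable {a b : ℝ} {u g : ℝ → ℝ}

theorem memLp (h : IsSobolev a b u g) (hab : a ≤ b) : MemLp g 2 (volume.restrict (Ioo a b)) := by
  have h1 := h.isPrim.intervalIntegrable
  have h2 := h.sq_integrable
  rw [intervalIntegrable_iff_integrableOn_Ioo_of_le hab] at h1 h2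
  exact (memLp_two_iff_integrable_sq h1.aestronglyMeasurable).2 h2

theorem mono {c d : ℝ} (h : IsSobolev a b u g) (hac : a ≤ c) (hcd : c ≤ d) (hdb : d ≤ b) :
    IsSobolev c d u g where
  isPrim := h.isPrim.mono hac hcd hdb
  sq_integrable := h.sq_integrable.mono_set (by
    rw [uIcc_of_le hcd, uIcc_of_le (hac.trans (hcd.trans hdb))]; exact Icc_subset_Icc hac hdb)

theorem of_isWeakDeriv (hab : a < b) (hu : ContinuousOn u (Icc a b)) (h : IsWeakDeriv a b u g) :
    IsSobolev a b u g where
  isPrim := h.isPrim hab hu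
  sq_integrable := by
    rw [intervalIntegrable_iff_integrableOn_Ioo_of_le hab.le]
    exact h.1.integrable_sq

theorem isWeakDeriv (h : IsSobolev a b u g) (hab : a ≤ b) : IsWeakDeriv a b u g :=
  h.isPrim.isWeakDeriv hab (h.memLp hab)

theorem of_hasDerivAt (hu : ∀ t, HasDerivAt u (g t) t) (hg : Continuous g) : IsSobolev a b u g :=
  ⟨IsPrim.of_hasDerivAt hu hg, (hg.pow 2).intervalIntegrable _ _⟩

theorem comp_intervalIntegrable (h : IsSobolev a b u g) (hab : a ≤ b) {p : ℝ → ℝ}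
    (hp : Continuous p) : IntervalIntegrable (fun t => p (u t)) volume a b :=
  ContinuousOn.intervalIntegrable (by
    rw [uIcc_of_le hab]; exact hp.comp_continuousOn (h.isPrim.continuousOn hab))

theorem sub_sq_intervalIntegrable (h : IsSobolev a b u g) (hab : a ≤ b) {p : ℝ → ℝ}
    (hp : Continuous p) : IntervalIntegrable (fun t => (g t - p (u t)) ^ 2) volume a b := by
  have h1 := h.isPrim.intervalIntegrable.mul_continuousOn (g := fun t => p (u t)) (by
    rw [uIcc_of_le hab]; exact hp.comp_continuousOn (h.isPrim.continuousOn hab))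
  have h2 := (h.sq_integrable.sub (h1.const_mul 2)).add
    (h.comp_intervalIntegrable hab (hp.pow 2))
  refine h2.congr fun t _ => ?_
  simp only [Pi.pow_apply]
  ring

/-- Completing the square in the free energy with a calibration `p = P'`. -/
theorem integral_action (h : IsSobolev a b u g) (hab : a ≤ b) {P p : ℝ → ℝ}
    (hP : ∀ y, HasDerivAt P (p y) y) (hp : Continuous p) :
    ∫ t in a..b, ((1 / 2) * g t ^ 2 + (1 / 2) * (1 - u t ^ 2) ^ 2) =
      (1 / 2) * (∫ t in a..b, (g t - p (u t)) ^ 2) + (P (u b) - P (u a)) +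
        (1 / 2) * ∫ t in a..b, ((1 - u t ^ 2) ^ 2 - p (u t) ^ 2) := by
  have hi := h.isPrim.comp hab hP hp
  rw [← hi.integral_eq_sub hab, ← intervalIntegral.integral_const_mul,
    ← intervalIntegral.integral_const_mul, ← intervalIntegral.integral_add
    ((h.sub_sq_intervalIntegrable hab hp).const_mul _) hi.intervalIntegrable,
    ← intervalIntegral.integral_add]
  · refine intervalIntegral.integral_congr fun t _ => ?_
    ring
  · exact ((h.sub_sq_intervalIntegrable hab hp).const_mul _).add hi.intervalIntegrable
  · exact (h.comp_intervalIntegrable (p := fun y => (1 - y ^ 2) ^ 2 - p y ^ 2) hab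
      (by fun_prop)).const_mul _

/-- The choice `p = 1 - y²` makes the last term of `integral_action` vanish. -/
theorem integral_action_eq_defect (h : IsSobolev a b u g) (hab : a ≤ b) :
    ∫ t in a..b, ((1 / 2) * g t ^ 2 + (1 / 2) * (1 - u t ^ 2) ^ 2) =
      (1 / 2) * defect a b u g + ((u b - u b ^ 3 / 3) - (u a - u a ^ 3 / 3)) := by
  rw [h.integral_action hab (P := fun y => y - y ^ 3 / 3) (p := fun y => 1 - y ^ 2)]
  · simp [defect]
  · intro y
    have := (hasDerivAt_id y).sub ((hasDerivAt_pow 3 y).div_const 3)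
    convert! this using 1
    norm_num
  · fun_prop

end IsSobolev

theorem defect_nonneg {a b : ℝ} (hab : a ≤ b) (u g : ℝ → ℝ) : 0 ≤ defect a b u g :=
  intervalIntegral.integral_nonneg hab fun _ _ => sq_nonneg _

theorem boundarySet_apply {ℓ : ℝ} (hℓ : 0 < ℓ) {x : Profile} (hx : x ∈ boundarySet ℓ) :
    x.1 ℓ = 1 ∧ x.1 (-ℓ) = -1 := by
  rw [hx ℓ (le_abs_self ℓ), hx (-ℓ) (by rw [abs_neg]; exact le_abs_self ℓ), Real.sign_of_pos hℓ,
    Real.sign_of_neg (by linarith)]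
  exact ⟨rfl, rfl⟩

theorem memW12_of_isSobolev {ℓ : ℝ} (hℓ : 0 < ℓ) {x : Profile} {g : ℝ → ℝ}
    (h : IsSobolev (-ℓ) ℓ x.1 g) : MemW12 (-ℓ) ℓ x.1 := by
  refine ⟨?_, g, h.isWeakDeriv (by linarith)⟩
  exact MemLp.of_bound x.1.continuous.aestronglyMeasurable ‖x.1‖
    (Eventually.of_forall fun t => x.1.norm_coe_le_norm t)

theorem freeEnergy_eq_integral {ℓ : ℝ} (hℓ : 0 < ℓ) {x : Profile} (hx : x ∈ boundarySet ℓ)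
    {g : ℝ → ℝ} (h : IsSobolev (-ℓ) ℓ x.1 g) :
    freeEnergy ℓ x = ENNReal.ofReal
      (∫ t in -ℓ..ℓ, ((1 / 2) * g t ^ 2 + (1 / 2) * (1 - x.1 t ^ 2) ^ 2)) := by
  have hle : -ℓ ≤ ℓ := by linarith
  have hW := memW12_of_isSobolev hℓ h
  rw [freeEnergy, if_pos ⟨hx, hW⟩, ← integral_Ioo_eq_interval hle,
    ofReal_integral_eq_lintegral_ofReal]
  · refine lintegral_congr_ae ?_
    have hw : IsWeakDeriv (-ℓ) ℓ x.1 (weakDeriv (-ℓ) ℓ x.1) := by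
      rw [weakDeriv, dif_pos hW.2]
      exact hW.2.choose_spec
    filter_upwards [hw.ae_eq (h.isWeakDeriv hle)] with t ht
    rw [ht, potential]
    congr 1
    ring
  · have h1 := (h.sq_integrable.const_mul (1 / 2)).add ((h.comp_intervalIntegrable
      (p := fun y => (1 - y ^ 2) ^ 2) hle (by fun_prop)).const_mul (1 / 2))
    rwa [intervalIntegrable_iff_integrableOn_Ioo_of_le hle] at h1
  · exact Eventually.of_forall fun t => by positivity

/-- The boundary values `±1` fix the primitive term at `2/3 - (-2/3) = 4/3`, so only the defect
distinguishes profiles. -/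
theorem freeEnergy_eq_defect {ℓ : ℝ} (hℓ : 0 < ℓ) {x : Profile} (hx : x ∈ boundarySet ℓ)
    {g : ℝ → ℝ} (h : IsSobolev (-ℓ) ℓ x.1 g) :
    freeEnergy ℓ x = ENNReal.ofReal (4 / 3 + (1 / 2) * defect (-ℓ) ℓ x.1 g) := by
  obtain ⟨h1, h2⟩ := boundarySet_apply hℓ hx
  rw [freeEnergy_eq_integral hℓ hx h, h.integral_action_eq_defect (by linarith), h1, h2]
  congr 1
  ring

theorem exists_isSobolev_of_freeEnergy_ne_top {ℓ : ℝ} (hℓ : 0 < ℓ) {x : Profile}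
    (h : freeEnergy ℓ x ≠ ⊤) : x ∈ boundarySet ℓ ∧ ∃ g, IsSobolev (-ℓ) ℓ x.1 g := by
  rw [freeEnergy] at h
  split_ifs at h with hc
  · obtain ⟨hx, -, g, hg⟩ := hc
    exact ⟨hx, g, IsSobolev.of_isWeakDeriv (by linarith) x.1.continuous.continuousOn hg⟩
  · exact absurd rfl h

/-! ### Existence and uniqueness of the minimizer by calibration -/

/-- The speed `√((1 - u²)₊² + c)` of the minimizers. -/
noncomputable def speed (c u : ℝ) : ℝ := √((max (1 - u ^ 2) 0) ^ 2 + c)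

/-- The time needed to go from `-1` to `u` at speed `speed c`. -/
noncomputable def travelTime (c u : ℝ) : ℝ := ∫ v in (-1)..u, (speed c v)⁻¹

theorem continuous_speed (c : ℝ) : Continuous (speed c) := by
  unfold speed
  fun_prop

section speed

variable {c : ℝ}

theorem speed_pos (hc : 0 < c) (u : ℝ) : 0 < speed c u := Real.sqrt_pos.2 (by positivity)

theorem speed_sq (hc : 0 < c) (u : ℝ) : speed c u ^ 2 = (max (1 - u ^ 2) 0) ^ 2 + c :=
  Real.sq_sqrt (by positivity)

/-- This is an equality on `[-1, 1]`, where the minimizer takes its values, and an inequality in the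
useful direction for competitors that leave this interval. The positive part in `speed` also keeps
the speed bounded, so that `travelTime c` is onto `ℝ`. -/
theorem speed_sq_le (hc : 0 < c) (u : ℝ) : speed c u ^ 2 ≤ (1 - u ^ 2) ^ 2 + c := by
  rw [speed_sq hc]
  rcases max_cases (1 - u ^ 2) 0 with h | h <;> rw [h.1]
  nlinarith [sq_nonneg (1 - u ^ 2)]

theorem speed_sq_of_mem (hc : 0 < c) {u : ℝ} (hu : u ∈ Icc (-1) 1) :
    speed c u ^ 2 = (1 - u ^ 2) ^ 2 + c := by
  rw [speed_sq hc, max_eq_left (by nlinarith [hu.1, hu.2])]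

theorem speed_le (u : ℝ) : speed c u ≤ √(1 + c) := by
  refine Real.sqrt_le_sqrt ?_
  have h0 : 0 ≤ max (1 - u ^ 2) 0 := le_max_right _ _
  have h1 : max (1 - u ^ 2) 0 ≤ 1 := max_le (by nlinarith [sq_nonneg u]) zero_le_one
  nlinarith

theorem hasDerivAt_travelTime (hc : 0 < c) (u : ℝ) :
    HasDerivAt (travelTime c) (speed c u)⁻¹ u := by
  have h : Continuous fun v => (speed c v)⁻¹ :=
    (continuous_speed c).inv₀ fun v => (speed_pos hc v).ne'
  exact intervalIntegral.integral_hasDerivAt_right (h.intervalIntegrable _ _)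
    (h.stronglyMeasurableAtFilter _ _) h.continuousAt

theorem strictMono_travelTime (hc : 0 < c) : StrictMono (travelTime c) :=
  strictMono_of_deriv_pos fun u => by
    rw [(hasDerivAt_travelTime hc u).deriv]
    exact inv_pos.2 (speed_pos hc u)

theorem travelTime_neg_one : travelTime c (-1) = 0 := intervalIntegral.integral_same

theorem surjective_travelTime (hc : 0 < c) : Function.Surjective (travelTime c) := by
  have hK : 0 < √(1 + c) := Real.sqrt_pos.2 (by linarith)
  -- Since the speed is at most `√(1 + c)`, subtracting this linear function leaves a monotone
  -- function; hence the travel time is unbounded in both directions.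
  have hd : ∀ u, HasDerivAt (fun u => travelTime c u - (u + 1) * (√(1 + c))⁻¹)
      ((speed c u)⁻¹ - 1 * (√(1 + c))⁻¹) u := fun u =>
    (hasDerivAt_travelTime hc u).sub (((hasDerivAt_id u).add_const 1).mul_const _)
  have hm : Monotone fun u => travelTime c u - (u + 1) * (√(1 + c))⁻¹ :=
    monotone_of_deriv_nonneg (fun u => (hd u).differentiableAt) fun u => by
      rw [(hd u).deriv, one_mul, sub_nonneg]
      exact inv_anti₀ (speed_pos hc u) (speed_le u)
  have hcont : Continuous (travelTime c) :=
    continuous_iff_continuousAt.2 fun u => (hasDerivAt_travelTime hc u).continuousAt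
  refine hcont.surjective ?_ ?_
  · refine tendsto_atTop_mono' atTop (f₁ := fun u => (u + 1) * (√(1 + c))⁻¹) ?_ ?_
    · filter_upwards [eventually_ge_atTop (-1)] with u hu
      have := hm hu
      simp only [travelTime_neg_one] at this
      linarith
    · exact (tendsto_atTop_add_const_right _ _ tendsto_id).atTop_mul_const (inv_pos.2 hK)
  · refine tendsto_atBot_mono' atBot (f₁ := fun u => (u + 1) * (√(1 + c))⁻¹) ?_ ?_
    · filter_upwards [eventually_le_atBot (-1)] with u hu
      have := hm hu
      simp only [travelTime_neg_one] at this
      linarith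
    · exact (tendsto_atBot_add_const_right _ _ tendsto_id).atBot_mul_const (inv_pos.2 hK)

end speed

/-- Intermediate values in `c = e^a`: the time to cross `[-1, 1]` depends continuously on `a`, is
small for large `c` and diverges logarithmically as `c → 0`. -/
theorem exists_travelTime_eq {ℓ : ℝ} (hℓ : 0 < ℓ) : ∃ c, 0 < c ∧ travelTime c 1 = 2 * ℓ := by
  have hcont : Continuous fun a : ℝ => travelTime (Real.exp a) 1 := by
    refine intervalIntegral.continuous_parametric_intervalIntegral_of_continuous' ?_ _ _
    have h : Continuous fun q : ℝ × ℝ => speed (Real.exp q.1) q.2 := by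
      unfold speed
      fun_prop
    exact h.inv₀ fun q => (speed_pos (Real.exp_pos _) _).ne'
  have hint : ∀ a, IntervalIntegrable (fun u => (speed (Real.exp a) u)⁻¹) volume (-1) 1 := fun a =>
    ((continuous_speed _).inv₀ fun v => (speed_pos (Real.exp_pos a) v).ne').intervalIntegrable _ _
  -- Here `c = ℓ⁻²`, so the speed is at least `1/ℓ` on an interval of length `2`.
  have hup : travelTime (Real.exp (-2 * Real.log ℓ)) 1 ≤ 2 * ℓ := by
    have h : ∀ u ∈ Icc (-1 : ℝ) 1, (speed (Real.exp (-2 * Real.log ℓ)) u)⁻¹ ≤ ℓ := by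
      intro u _
      refine inv_le_of_inv_le₀ hℓ (Real.le_sqrt_of_sq_le ?_)
      have : Real.exp (-2 * Real.log ℓ) = ℓ⁻¹ ^ 2 := by
        rw [show -2 * Real.log ℓ = -Real.log ℓ + -Real.log ℓ by ring, Real.exp_add, Real.exp_neg,
          Real.exp_log hℓ, sq]
      rw [this]
      nlinarith [sq_nonneg (max (1 - u ^ 2) 0)]
    have := intervalIntegral.integral_mono_on (by norm_num) (hint _) intervalIntegrable_const h
    rw [intervalIntegral.integral_const] at this
    calc _ ≤ _ := this
      _ = 2 * ℓ := by norm_num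
  -- Here `c = σ²` with `σ = e^{-4ℓ}`. On `[-1, 1]` the speed is at most `2(1 - u) + σ`, so the
  -- crossing takes at least `(log(4 + σ) - log σ)/2 ≥ 2ℓ`.
  have hlow : 2 * ℓ ≤ travelTime (Real.exp (-8 * ℓ)) 1 := by
    set σ := Real.exp (-4 * ℓ) with hσ
    have hσ0 : 0 < σ := Real.exp_pos _
    have hσ2 : Real.exp (-8 * ℓ) = σ ^ 2 := by
      rw [hσ, ← Real.exp_nat_mul]
      congr 1
      push_cast
      ring
    have hpos : ∀ u ∈ Icc (-1 : ℝ) 1, 0 < 2 * (1 - u) + σ := fun u hu => by linarith [hu.2]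
    have hI : IntervalIntegrable (fun u => (2 * (1 - u) + σ)⁻¹) volume (-1) 1 := by
      refine ContinuousOn.intervalIntegrable ?_
      rw [uIcc_of_le (by norm_num)]
      exact ContinuousOn.inv₀ (by fun_prop) fun u hu => (hpos u hu).ne'
    have h : ∀ u ∈ Icc (-1 : ℝ) 1,
        (2 * (1 - u) + σ)⁻¹ ≤ (speed (Real.exp (-8 * ℓ)) u)⁻¹ := by
      intro u hu
      refine inv_anti₀ (speed_pos (Real.exp_pos _) u) ?_
      rw [speed, hσ2]
      refine Real.sqrt_le_iff.2 ⟨(hpos u hu).le, ?_⟩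
      have h0 : 0 ≤ max (1 - u ^ 2) 0 := le_max_right _ _
      have h1 : max (1 - u ^ 2) 0 ≤ 2 * (1 - u) :=
        max_le (by nlinarith [hu.1, hu.2]) (by linarith [hu.2])
      nlinarith
    have h1 := intervalIntegral.integral_mono_on (by norm_num) hI (hint _) h
    have h2 : ∫ u in (-1 : ℝ)..1, (2 * (1 - u) + σ)⁻¹ =
        (-(1 / 2) * Real.log (2 * (1 - 1) + σ)) - (-(1 / 2) * Real.log (2 * (1 - -1) + σ)) := by
      refine intervalIntegral.integral_eq_sub_of_hasDerivAt
        (f := fun u => -(1 / 2) * Real.log (2 * (1 - u) + σ)) (fun u hu => ?_) hI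
      rw [uIcc_of_le (by norm_num)] at hu
      have := (((((hasDerivAt_id u).const_sub 1).const_mul 2).add_const σ).log
        (hpos u hu).ne').const_mul (-(1 / 2))
      convert! this using 1
      simp only [id]
      ring
    rw [h2] at h1
    have h3 : Real.log (2 * (1 - 1) + σ) = -4 * ℓ := by
      rw [hσ]
      simp
    have h4 : 0 ≤ Real.log (2 * (1 - -1) + σ) := Real.log_nonneg (by linarith)
    rw [h3] at h1
    refine le_trans ?_ h1
    generalize Real.log (2 * (1 - -1) + σ) = Λ at h4 ⊢
    linarith
  obtain ⟨a, ha⟩ := mem_range_of_exists_le_of_exists_ge hcont ⟨_, hup⟩ ⟨_, hlow⟩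
  exact ⟨Real.exp a, Real.exp_pos a, ha⟩

theorem IsSobolev.congr {a b : ℝ} {u v g : ℝ → ℝ} (h : IsSobolev a b u g) (hab : a ≤ b)
    (huv : EqOn u v (Icc a b)) : IsSobolev a b v g where
  isPrim := ⟨h.isPrim.intervalIntegrable, fun t ht => by
    rw [← huv ht, ← huv (left_mem_Icc.2 hab)]; exact h.isPrim.eq_add_integral t ht⟩
  sq_integrable := h.sq_integrable

/-- The solution of `m' = speed c m` with `m(-ℓ) = -1` and `m(ℓ) = 1`, extended by constants. -/
theorem exists_speed_profile {ℓ c : ℝ} (hℓ : 0 < ℓ) (hc : 0 < c)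
    (h : travelTime c 1 = 2 * ℓ) :
    ∃ m : Profile, m ∈ boundarySet ℓ ∧ IsSobolev (-ℓ) ℓ m.1 (fun t => speed c (m.1 t)) ∧
      (∀ t, m.1 t ∈ Icc (-1) 1) ∧ ∀ t ∈ Icc (-ℓ) ℓ, travelTime c (m.1 t) = t + ℓ := by
  let e := (strictMono_travelTime hc).orderIsoOfSurjective _ (surjective_travelTime hc)
  have he : ∀ u, e u = travelTime c u := fun u => rfl
  have hes : ∀ t, travelTime c (e.symm t) = t := fun t => e.apply_symm_apply t
  set m₀ : ℝ → ℝ := fun t => e.symm (t + ℓ) with hm₀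
  have hmono : StrictMono m₀ := fun s t hst => e.symm.strictMono (by linarith)
  have hleft : m₀ (-ℓ) = -1 := by
    rw [hm₀]
    simp only [neg_add_cancel]
    rw [OrderIso.symm_apply_eq, he, travelTime_neg_one]
  have hright : m₀ ℓ = 1 := by
    rw [hm₀]
    simp only
    rw [OrderIso.symm_apply_eq, he, h]
    ring
  have hder : ∀ t, HasDerivAt m₀ (speed c (m₀ t)) t := fun t => by
    have h1 : HasDerivAt (fun s => e.symm s) ((speed c (e.symm (t + ℓ)))⁻¹)⁻¹ (t + ℓ) :=
      (hasDerivAt_travelTime hc (e.symm (t + ℓ))).of_local_left_inverse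
        e.symm.continuous.continuousAt (inv_ne_zero (speed_pos hc _).ne')
        (Eventually.of_forall hes)
    rw [inv_inv] at h1
    exact h1.comp_add_const t ℓ
  have hm₀c : Continuous m₀ := continuous_iff_continuousAt.2 fun t => (hder t).continuousAt
  have hge : ∀ t, ℓ ≤ t → max (-1) (min 1 (m₀ t)) = 1 := fun t ht => by
    have : 1 ≤ m₀ t := hright ▸ hmono.monotone ht
    rw [min_eq_left this, max_eq_right (by norm_num)]
  have hle : ∀ t, t ≤ -ℓ → max (-1) (min 1 (m₀ t)) = -1 := fun t ht => by
    have : m₀ t ≤ -1 := hleft ▸ hmono.monotone ht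
    rw [min_eq_right (by linarith), max_eq_left this]
  have hmid : ∀ t ∈ Icc (-ℓ) ℓ, m₀ t = max (-1) (min 1 (m₀ t)) := fun t ht => by
    have h1 : m₀ t ≤ 1 := hright ▸ hmono.monotone ht.2
    have h2 : -1 ≤ m₀ t := hleft ▸ hmono.monotone ht.1
    rw [min_eq_right h1, max_eq_right h2]
  obtain ⟨m, hm⟩ := exists_profile (fun t => max (-1) (min 1 (m₀ t))) (by fun_prop)
    (tendsto_const_nhds.congr' (by
      filter_upwards [eventually_ge_atTop ℓ] with t ht using (hge t ht).symm))
    (tendsto_const_nhds.congr' (by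
      filter_upwards [eventually_le_atBot (-ℓ)] with t ht using (hle t ht).symm))
  have hmm : EqOn m₀ m.1 (Icc (-ℓ) ℓ) := fun t ht => by rw [hm]; exact hmid t ht
  refine ⟨m, fun t ht => ?_, ?_, fun t => ?_, fun t ht => ?_⟩
  · rw [hm]
    rcases le_abs.1 ht with h1 | h1
    · rw [hge t h1, Real.sign_of_pos (by linarith)]
    · rw [hle t (by linarith), Real.sign_of_neg (by linarith)]
  · have h1 : IsSobolev (-ℓ) ℓ m₀ (fun t => speed c (m₀ t)) :=
      IsSobolev.of_hasDerivAt hder ((continuous_speed c).comp hm₀c)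
    have h2 := h1.congr (by linarith) hmm
    refine ⟨⟨?_, fun t ht => ?_⟩, ?_⟩
    · exact ((continuous_speed c).comp m.1.continuous).intervalIntegrable _ _
    · rw [h2.isPrim.eq_add_integral t ht]
      congr 1
      refine intervalIntegral.integral_congr fun s hs => ?_
      rw [uIcc_of_le ht.1] at hs
      rw [hmm ⟨hs.1, hs.2.trans ht.2⟩]
    · exact (((continuous_speed c).comp m.1.continuous).pow 2).intervalIntegrable _ _
  · rw [hm]
    exact ⟨le_max_left _ _, max_le (by norm_num) (min_le_left _ _)⟩
  · rw [← hmm ht]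
    exact hes _

/-- Calibrate with `p = speed c`: by `speed_sq_le` the remainder in `integral_action` is at least
`-c/2` times the length `2ℓ`, so every action is at least the constant `K` plus half the squared
norm of `x' - speed c x`. The solution of the first order equation attains `K`, and any other
minimizer must solve the same equation. -/
theorem existsUnique_isMinimizer {ℓ : ℝ} (hℓ : 0 < ℓ) : ∃! m : Profile, IsMinimizer ℓ m := by
  obtain ⟨c, hc, hT⟩ := exists_travelTime_eq hℓ
  obtain ⟨m, hmb, hmS, hmI, hmT⟩ := exists_speed_profile hℓ hc hT
  have hle : -ℓ ≤ ℓ := by linarith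
  have hsc := continuous_speed c
  set P : ℝ → ℝ := fun y => ∫ v in (0 : ℝ)..y, speed c v with hPdef
  have hP : ∀ y, HasDerivAt P (speed c y) y := fun y =>
    intervalIntegral.integral_hasDerivAt_right (hsc.intervalIntegrable _ _)
      (hsc.stronglyMeasurableAtFilter _ _) hsc.continuousAt
  set K := (P 1 - P (-1)) - c * ℓ with hK
  have hact : ∀ x ∈ boundarySet ℓ, ∀ g, IsSobolev (-ℓ) ℓ x.1 g →
      K + (1 / 2) * (∫ t in -ℓ..ℓ, (g t - speed c (x.1 t)) ^ 2) ≤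
        ∫ t in -ℓ..ℓ, ((1 / 2) * g t ^ 2 + (1 / 2) * (1 - x.1 t ^ 2) ^ 2) := by
    intro x hx g hg
    obtain ⟨h1, h2⟩ := boundarySet_apply hℓ hx
    rw [hg.integral_action hle hP hsc, h1, h2]
    have h3 := intervalIntegral.integral_mono_on (μ := volume) (f := fun _ => -c)
      (g := fun t => (1 - x.1 t ^ 2) ^ 2 - speed c (x.1 t) ^ 2) hle intervalIntegrable_const
      (hg.comp_intervalIntegrable (p := fun y => (1 - y ^ 2) ^ 2 - speed c y ^ 2) hle
        (by fun_prop)) fun t _ => by linarith [speed_sq_le hc (x.1 t)]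
    rw [intervalIntegral.integral_const, smul_eq_mul] at h3
    linarith
  have hmin : ∫ t in -ℓ..ℓ, ((1 / 2) * speed c (m.1 t) ^ 2 + (1 / 2) * (1 - m.1 t ^ 2) ^ 2) =
      K := by
    obtain ⟨h1, h2⟩ := boundarySet_apply hℓ hmb
    rw [hmS.integral_action hle hP hsc, h1, h2]
    have h3 : ∫ t in -ℓ..ℓ, ((1 - m.1 t ^ 2) ^ 2 - speed c (m.1 t) ^ 2) = ∫ t in -ℓ..ℓ, -c :=
      intervalIntegral.integral_congr fun t _ => by
        rw [speed_sq_of_mem hc (hmI t)]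
        ring
    rw [h3, intervalIntegral.integral_const, smul_eq_mul]
    simp only [sub_self, ne_eq, OfNat.ofNat_ne_zero, not_false_eq_true, zero_pow,
      intervalIntegral.integral_zero]
    linarith
  have hK0 : 0 ≤ K := hmin ▸ intervalIntegral.integral_nonneg hle fun t _ => by positivity
  have hFm : freeEnergy ℓ m = ENNReal.ofReal K := by rw [freeEnergy_eq_integral hℓ hmb hmS, hmin]
  refine ⟨m, ⟨hmb, fun x hx => ?_⟩, fun y hy => ?_⟩
  · by_cases htop : freeEnergy ℓ x = ⊤
    · rw [htop]
      exact le_top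
    · obtain ⟨-, g, hg⟩ := exists_isSobolev_of_freeEnergy_ne_top hℓ htop
      rw [hFm, freeEnergy_eq_integral hℓ hx hg]
      refine ENNReal.ofReal_le_ofReal (le_trans ?_ (hact x hx g hg))
      have : 0 ≤ ∫ t in -ℓ..ℓ, (g t - speed c (x.1 t)) ^ 2 :=
        intervalIntegral.integral_nonneg hle fun t _ => sq_nonneg _
      linarith
  · have h1 := hy.2 m hmb
    obtain ⟨hyb, g, hg⟩ := exists_isSobolev_of_freeEnergy_ne_top hℓ
      (x := y) (ne_top_of_le_ne_top (hFm ▸ ENNReal.ofReal_ne_top) h1)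
    rw [hFm, freeEnergy_eq_integral hℓ hyb hg, ENNReal.ofReal_le_ofReal_iff hK0] at h1
    have h2 := hact y hyb g hg
    have h3 : ∫ t in -ℓ..ℓ, (g t - speed c (y.1 t)) ^ 2 = 0 :=
      le_antisymm (by linarith) (intervalIntegral.integral_nonneg hle fun t _ => sq_nonneg _)
    rw [intervalIntegral.integral_eq_zero_iff_of_le_of_nonneg_ae hle
      (Eventually.of_forall fun t => sq_nonneg _) (hg.sub_sq_intervalIntegrable hle hsc),
      Filter.EventuallyEq, ae_restrict_iff' measurableSet_Ioc] at h3
    have hinv : Continuous fun v => (speed c v)⁻¹ := hsc.inv₀ fun v => (speed_pos hc v).ne'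
    -- Composition with `travelTime c` turns `y' = speed c y` into an equation with derivative `1`,
    -- so `y` is determined by its value at `-ℓ`.
    have hτ := hg.isPrim.comp hle (hasDerivAt_travelTime hc) hinv
    obtain ⟨-, hy2⟩ := boundarySet_apply hℓ hyb
    have key : EqOn y.1 m.1 (Icc (-ℓ) ℓ) := fun t ht => by
      refine (strictMono_travelTime hc).injective ?_
      rw [hmT t ht, hτ.eq_add_integral t ht, hy2, travelTime_neg_one]
      have : ∫ s in -ℓ..t, (speed c (y.1 s))⁻¹ * g s = ∫ s in -ℓ..t, (1 : ℝ) := by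
        refine intervalIntegral.integral_congr_ae ?_
        filter_upwards [h3] with s hs hm
        rw [uIoc_of_le ht.1] at hm
        have h4 : g s = speed c (y.1 s) :=
          sub_eq_zero.1 (pow_eq_zero_iff two_ne_zero |>.1 (hs ⟨hm.1, hm.2.trans ht.2⟩))
        rw [h4, inv_mul_cancel₀ (speed_pos hc _).ne']
      rw [this, intervalIntegral.integral_const, smul_eq_mul]
      ring
    refine Subtype.ext (BoundedContinuousFunction.ext fun t => ?_)
    by_cases ht : ℓ ≤ |t|
    · rw [hyb t ht, hmb t ht]
    · exact key (abs_le.1 (not_le.1 ht).le)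

/-! ### Integrals of hyperbolic functions and Cauchy–Schwarz -/

theorem hasDerivAt_tanh (t : ℝ) : HasDerivAt Real.tanh (1 - Real.tanh t ^ 2) t := by
  have h := (Real.hasDerivAt_sinh t).div (Real.hasDerivAt_cosh t) (Real.cosh_pos t).ne'
  have e : Real.tanh = Real.sinh / Real.cosh := funext Real.tanh_eq_sinh_div_cosh
  rw [e]
  convert! h using 1
  have := (Real.cosh_pos t).ne'
  simp only [Pi.div_apply]
  field_simp

theorem continuous_tanh : Continuous Real.tanh :=
  continuous_iff_continuousAt.2 fun t => (hasDerivAt_tanh t).continuousAt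

theorem hasDerivAt_log_cosh (t : ℝ) :
    HasDerivAt (fun s => Real.log (Real.cosh s)) (Real.tanh t) t := by
  rw [Real.tanh_eq_sinh_div_cosh]
  exact (Real.hasDerivAt_cosh t).log (Real.cosh_pos t).ne'

theorem integral_tanh (a b : ℝ) :
    ∫ t in a..b, Real.tanh t = Real.log (Real.cosh b) - Real.log (Real.cosh a) :=
  intervalIntegral.integral_eq_sub_of_hasDerivAt (fun t _ => hasDerivAt_log_cosh t)
    (continuous_tanh.intervalIntegrable _ _)

/-- Integrate the derivative of `cosh³ sinh`, which is `4 cosh⁴ - 3 cosh²`. The leading constant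
`1/4` is sharp as `L → ∞` and produces the constant `16` of the limit. -/
theorem integral_cosh_pow_four_le {L : ℝ} (hL : 0 ≤ L) :
    ∫ s in (0 : ℝ)..L, Real.cosh s ^ 4 ≤
      (1 / 4) * (Real.cosh L ^ 4 + 3 * L * Real.cosh L ^ 2) := by
  have hd : ∀ s : ℝ, HasDerivAt (fun s => Real.cosh s ^ 3 * Real.sinh s)
      (4 * Real.cosh s ^ 4 - 3 * Real.cosh s ^ 2) s := fun s => by
    have := ((Real.hasDerivAt_cosh s).pow 3).mul (Real.hasDerivAt_sinh s)
    convert! this using 1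
    have := Real.cosh_sq s
    have : Real.sinh s ^ 2 = Real.cosh s ^ 2 - 1 := by linarith
    simp only [Pi.pow_apply]
    push_cast
    linear_combination (-3 * Real.cosh s ^ 2) * this
  have h1 := intervalIntegral.integral_eq_sub_of_hasDerivAt (a := 0) (b := L) (fun s _ => hd s)
    (by apply Continuous.intervalIntegrable; fun_prop)
  rw [intervalIntegral.integral_sub (by apply Continuous.intervalIntegrable; fun_prop)
    (by apply Continuous.intervalIntegrable; fun_prop), intervalIntegral.integral_const_mul,
    intervalIntegral.integral_const_mul] at h1
  have h2 : ∫ s in (0 : ℝ)..L, Real.cosh s ^ 2 ≤ ∫ s in (0 : ℝ)..L, Real.cosh L ^ 2 := by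
    refine intervalIntegral.integral_mono_on hL
      (by apply Continuous.intervalIntegrable; fun_prop) intervalIntegrable_const fun s hs => ?_
    have : Real.cosh s ≤ Real.cosh L := by
      rw [Real.cosh_le_cosh, abs_of_nonneg hs.1, abs_of_nonneg hL]
      exact hs.2
    exact pow_le_pow_left₀ (Real.cosh_pos s).le this 2
  rw [intervalIntegral.integral_const, smul_eq_mul, sub_zero] at h2
  rw [Real.sinh_zero, mul_zero, sub_zero] at h1
  have h3 : Real.cosh L ^ 3 * Real.sinh L ≤ Real.cosh L ^ 4 := by
    have := Real.sinh_lt_cosh L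
    have := pow_pos (Real.cosh_pos L) 3
    nlinarith
  linarith

/-- Cauchy–Schwarz, from the discriminant of the nonnegative quadratic `r ↦ ∫ (r k - f)²`. -/
theorem integral_mul_sq_le {a b : ℝ} {k f : ℝ → ℝ} (hab : a ≤ b)
    (hk : IntervalIntegrable (fun t => k t ^ 2) volume a b)
    (hf : IntervalIntegrable (fun t => f t ^ 2) volume a b)
    (hkf : IntervalIntegrable (fun t => k t * f t) volume a b) :
    (∫ t in a..b, k t * f t) ^ 2 ≤ (∫ t in a..b, k t ^ 2) * ∫ t in a..b, f t ^ 2 := by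
  have h : ∀ r : ℝ, 0 ≤ (∫ t in a..b, k t ^ 2) * (r * r) + (-2 * ∫ t in a..b, k t * f t) * r +
      ∫ t in a..b, f t ^ 2 := fun r => by
    have e : (∫ t in a..b, k t ^ 2) * (r * r) + (-2 * ∫ t in a..b, k t * f t) * r +
        ∫ t in a..b, f t ^ 2 = ∫ t in a..b, (r * k t - f t) ^ 2 := by
      have : (fun t => (r * k t - f t) ^ 2) =
          fun t => (r * r) * k t ^ 2 + (-2 * r) * (k t * f t) + f t ^ 2 := by
        ext t
        ring
      rw [this, intervalIntegral.integral_add ((hk.const_mul _).add (hkf.const_mul _)) hf,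
        intervalIntegral.integral_add (hk.const_mul _) (hkf.const_mul _),
        intervalIntegral.integral_const_mul, intervalIntegral.integral_const_mul]
      ring
    rw [e]
    exact intervalIntegral.integral_nonneg hab fun t _ => sq_nonneg _
  have := discrim_le_zero h
  rw [discrim] at this
  nlinarith

theorem IsSobolev.defect_intervalIntegrable {a b : ℝ} {u g : ℝ → ℝ} (h : IsSobolev a b u g)
    (hab : a ≤ b) : IntervalIntegrable (fun t => g t - (1 - u t ^ 2)) volume a b :=
  h.isPrim.intervalIntegrable.sub
    (h.comp_intervalIntegrable (p := fun y => 1 - y ^ 2) hab (by fun_prop))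

theorem IsSobolev.defect_sq_intervalIntegrable {a b : ℝ} {u g : ℝ → ℝ} (h : IsSobolev a b u g)
    (hab : a ≤ b) : IntervalIntegrable (fun t => (g t - (1 - u t ^ 2)) ^ 2) volume a b :=
  h.sub_sq_intervalIntegrable (p := fun y => 1 - y ^ 2) hab (by fun_prop)

/-- Cauchy–Schwarz against `1`. The factor `b - a` is harmless later, where the defect is
exponentially small in the length. -/
theorem IsSobolev.integral_abs_sq_le {a b : ℝ} {u g : ℝ → ℝ} (h : IsSobolev a b u g)
    (hab : a ≤ b) :
    (∫ t in a..b, |g t - (1 - u t ^ 2)|) ^ 2 ≤ (b - a) * defect a b u g := by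
  have h1 := (h.defect_intervalIntegrable hab).abs
  have h2 := h.defect_sq_intervalIntegrable hab
  have := integral_mul_sq_le (k := fun _ => 1) (f := fun t => |g t - (1 - u t ^ 2)|) hab
    (by simp) (by simpa [sq_abs] using h2) (by simpa using h1)
  simpa [sq_abs, defect] using this

/-! ### Deviation from `tanh` on one side of a zero -/

section HalfLine

variable {L η : ℝ} {u g : ℝ → ℝ}

/-- The solution operator of the linearized equation `y' + (u + tanh) y = f` for
`y = u - tanh`. -/
theorem IsSobolev.sub_tanh_eq_integral (h : IsSobolev 0 L u g) (h0 : u 0 = 0) {t : ℝ}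
    (ht : t ∈ Icc 0 L) :
    u t - Real.tanh t = ∫ s in (0 : ℝ)..t,
      Real.exp (-∫ r in s..t, (u r + Real.tanh r)) * (g s - (1 - u s ^ 2)) := by
  have hL : 0 ≤ L := ht.1.trans ht.2
  have hi : IntervalIntegrable (fun r => u r + Real.tanh r) volume 0 L :=
    (h.comp_intervalIntegrable (p := fun y => y) hL continuous_id).add
      (continuous_tanh.intervalIntegrable _ _)
  have hi' : ∀ s ∈ Icc 0 L, IntervalIntegrable (fun r => u r + Real.tanh r) volume 0 s :=
    fun s hs => hi.mono_set (by
      rw [uIcc_of_le hL, uIcc_of_le hs.1]; exact Icc_subset_Icc_right hs.2)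
  have hS : IsPrim 0 L (fun t => ∫ r in (0 : ℝ)..t, (u r + Real.tanh r))
      (fun r => u r + Real.tanh r) := ⟨hi, fun t _ => by simp⟩
  have hw : IsPrim 0 L Real.tanh (fun t => 1 - Real.tanh t ^ 2) :=
    IsPrim.of_hasDerivAt hasDerivAt_tanh (by have := continuous_tanh; fun_prop)
  have hp := (hS.comp hL Real.hasDerivAt_exp Real.continuous_exp).mul (h.isPrim.sub hw hL) hL
  have h1 := hp.eq_add_integral t ht
  simp only [h0, Real.tanh_zero, sub_zero, mul_zero, zero_add] at h1
  have h2 : u t - Real.tanh t = Real.exp (-∫ r in (0 : ℝ)..t, (u r + Real.tanh r)) *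
      (Real.exp (∫ r in (0 : ℝ)..t, (u r + Real.tanh r)) * (u t - Real.tanh t)) := by
    rw [← mul_assoc, ← Real.exp_add, neg_add_cancel, Real.exp_zero, one_mul]
  rw [h2, h1, ← intervalIntegral.integral_const_mul]
  refine intervalIntegral.integral_congr fun s hs => ?_
  rw [uIcc_of_le ht.1] at hs
  have h3 : ∫ r in s..t, (u r + Real.tanh r) = (∫ r in (0 : ℝ)..t, (u r + Real.tanh r)) -
      ∫ r in (0 : ℝ)..s, (u r + Real.tanh r) :=
    (intervalIntegral.integral_interval_sub_left (hi' t ht)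
      (hi' s ⟨hs.1, hs.2.trans ht.2⟩)).symm
  rw [h3, neg_sub, sub_eq_neg_add (∫ r in (0 : ℝ)..s, (u r + Real.tanh r)), Real.exp_add]
  ring

/-- For `u = tanh` the exponent is `-2 log(cosh t / cosh s)`, which gives the quotient of squares; a
deviation of at most `2η` costs the exponential factor. The deviation is controlled only on the open
interval, so that the bound applies up to a first exit time. -/
theorem IsSobolev.exp_neg_integral_le (h : IsSobolev 0 L u g) {s t : ℝ}
    (hs : 0 ≤ s) (hst : s ≤ t) (htL : t ≤ L) (hη : 0 ≤ η)
    (hy : ∀ r ∈ Ioo 0 t, |u r - Real.tanh r| ≤ 2 * η) :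
    Real.exp (-∫ r in s..t, (u r + Real.tanh r)) ≤
      Real.exp (2 * (η * L)) * (Real.cosh s ^ 2 / Real.cosh t ^ 2) := by
  have hi : IntervalIntegrable (fun r => u r + Real.tanh r) volume s t :=
    ((h.mono hs hst htL).comp_intervalIntegrable (p := fun y => y) hst continuous_id).add
      (continuous_tanh.intervalIntegrable _ _)
  have hj : IntervalIntegrable (fun r => 2 * Real.tanh r - 2 * η) volume s t := by
    have := continuous_tanh
    apply Continuous.intervalIntegrable
    fun_prop
  have h1 := intervalIntegral.integral_mono_on_of_le_Ioo hst hj hi fun r hr => by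
    have := abs_le.1 (hy r ⟨hs.trans_lt hr.1, hr.2⟩)
    linarith [this.1]
  rw [intervalIntegral.integral_sub (by
      have := continuous_tanh
      apply Continuous.intervalIntegrable
      fun_prop) intervalIntegrable_const,
    intervalIntegral.integral_const_mul, integral_tanh, intervalIntegral.integral_const,
    smul_eq_mul] at h1
  have h2 : Real.exp (2 * (η * L)) * (Real.cosh s ^ 2 / Real.cosh t ^ 2) =
      Real.exp (2 * (η * L) + 2 * (Real.log (Real.cosh s) - Real.log (Real.cosh t))) := by
    rw [Real.exp_add, ← Real.log_div (Real.cosh_pos s).ne' (Real.cosh_pos t).ne', ← div_pow]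
    congr 1
    rw [two_mul, Real.exp_add, Real.exp_log (div_pos (Real.cosh_pos s) (Real.cosh_pos t)), sq]
  rw [h2]
  refine Real.exp_le_exp.2 ?_
  have h3 : (t - s) * η ≤ L * η := by
    refine mul_le_mul_of_nonneg_right ?_ hη
    linarith
  linarith

/-- A function starting from `0` with small `L¹` defect stays close to `tanh`. -/
theorem IsSobolev.abs_sub_tanh_lt (h : IsSobolev 0 L u g) (hL : 0 ≤ L) (h0 : u 0 = 0)
    (hη : 0 < η) (hηL : η * L ≤ 1 / 8)
    (hf : ∫ t in (0 : ℝ)..L, |g t - (1 - u t ^ 2)| ≤ η) :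
    ∀ t ∈ Icc 0 L, |u t - Real.tanh t| < 2 * η := by
  by_contra! hcon
  obtain ⟨t₀, ht₀, hb₀⟩ := hcon
  have hcont : ContinuousOn (fun t => |u t - Real.tanh t|) (Icc 0 L) :=
    ((h.isPrim.continuousOn hL).sub continuous_tanh.continuousOn).abs
  have hcl : IsClosed (Icc 0 L ∩ (fun t => |u t - Real.tanh t|) ⁻¹' Ici (2 * η)) :=
    hcont.preimage_isClosed_of_isClosed isClosed_Icc isClosed_Ici
  -- Bootstrap at the first time `τ` at which the deviation reaches `2η`. Before `τ` the kernel is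
  -- at most `e^{1/4} ≤ 3/2`, so the deviation at `τ` is at most `3η/2`, a contradiction.
  obtain ⟨τ, ⟨hτ, hbτ⟩, hmin⟩ := (isCompact_Icc.of_isClosed_subset hcl
    inter_subset_left).exists_isLeast ⟨t₀, ht₀, hb₀⟩
  have hy : ∀ r ∈ Ioo 0 τ, |u r - Real.tanh r| ≤ 2 * η := fun r hr => by
    by_contra hc
    have := hmin ⟨⟨hr.1.le, hr.2.le.trans hτ.2⟩, (not_le.1 hc).le⟩
    linarith [hr.2]
  have hexp : Real.exp (2 * (η * L)) ≤ 3 / 2 := by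
    have h1 : Real.exp (2 * (η * L)) ≤ Real.exp (1 / 4) := Real.exp_le_exp.2 (by linarith)
    have h2 : Real.exp (1 / 4) ^ 4 ≤ (3 / 2 : ℝ) ^ 4 := by
      rw [← Real.exp_nat_mul]
      norm_num
      linarith [Real.exp_one_lt_d9]
    exact h1.trans (le_of_pow_le_pow_left₀ (by norm_num) (by norm_num) h2)
  have hker : ∀ s ∈ Icc 0 τ, Real.exp (-∫ r in s..τ, (u r + Real.tanh r)) ≤ 3 / 2 := by
    intro s hs
    refine (h.exp_neg_integral_le hs.1 hs.2 hτ.2 hη.le hy).trans ?_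
    have : Real.cosh s ^ 2 / Real.cosh τ ^ 2 ≤ 1 := by
      refine div_le_one_of_le₀ (pow_le_pow_left₀ (Real.cosh_pos s).le ?_ 2) (by positivity)
      rw [Real.cosh_le_cosh, abs_of_nonneg hs.1, abs_of_nonneg hτ.1]
      exact hs.2
    have := Real.exp_pos (2 * (η * L))
    nlinarith
  have hd := (h.defect_intervalIntegrable hL).abs
  have hdτ : IntervalIntegrable (fun t => |g t - (1 - u t ^ 2)|) volume 0 τ :=
    hd.mono_set (by rw [uIcc_of_le hL, uIcc_of_le hτ.1]; exact Icc_subset_Icc_right hτ.2)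
  have hle : |u τ - Real.tanh τ| ≤ ∫ s in (0 : ℝ)..τ, (3 / 2) * |g s - (1 - u s ^ 2)| := by
    rw [h.sub_tanh_eq_integral h0 hτ, ← Real.norm_eq_abs]
    refine intervalIntegral.norm_integral_le_of_norm_le hτ.1
      (Eventually.of_forall fun s hs => ?_) (hdτ.const_mul _)
    rw [norm_mul, Real.norm_eq_abs, Real.norm_eq_abs, abs_of_pos (Real.exp_pos _)]
    exact mul_le_mul_of_nonneg_right (hker s ⟨hs.1.le, hs.2⟩) (abs_nonneg _)
  rw [intervalIntegral.integral_const_mul] at hle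
  have hmono : ∫ s in (0 : ℝ)..τ, |g s - (1 - u s ^ 2)| ≤
      ∫ s in (0 : ℝ)..L, |g s - (1 - u s ^ 2)| :=
    intervalIntegral.integral_mono_interval le_rfl hτ.1 hτ.2
      (Eventually.of_forall fun s => abs_nonneg _) hd
  have : 2 * η ≤ |u τ - Real.tanh τ| := hbτ
  linarith

/-- The cost of the deviation from `tanh` at the end point. -/
theorem IsSobolev.sub_tanh_sq_le (h : IsSobolev 0 L u g) (hL : 0 ≤ L) (h0 : u 0 = 0)
    (hη : 0 ≤ η) (hy : ∀ t ∈ Icc 0 L, |u t - Real.tanh t| ≤ 2 * η) :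
    (u L - Real.tanh L) ^ 2 ≤ Real.exp (4 * (η * L)) *
      ((1 / 4) * (1 + 3 * L / Real.cosh L ^ 2)) * defect 0 L u g := by
  have hLm : L ∈ Icc 0 L := right_mem_Icc.2 hL
  -- An explicit majorant of the Duhamel kernel with final time `L`, to be paired with the defect by
  -- Cauchy–Schwarz.
  set k : ℝ → ℝ := fun s => Real.exp (2 * (η * L)) * (Real.cosh s ^ 2 / Real.cosh L ^ 2) with hk
  have hkc : Continuous k := by fun_prop
  have hd := (h.defect_intervalIntegrable hL).abs
  have hd2 := h.defect_sq_intervalIntegrable hL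
  have hkd : IntervalIntegrable (fun s => k s * |g s - (1 - u s ^ 2)|) volume 0 L :=
    hd.continuousOn_mul hkc.continuousOn
  have hle : |u L - Real.tanh L| ≤ ∫ s in (0 : ℝ)..L, k s * |g s - (1 - u s ^ 2)| := by
    rw [h.sub_tanh_eq_integral h0 hLm, ← Real.norm_eq_abs]
    refine intervalIntegral.norm_integral_le_of_norm_le hL
      (Eventually.of_forall fun s hs => ?_) hkd
    rw [norm_mul, Real.norm_eq_abs, Real.norm_eq_abs, abs_of_pos (Real.exp_pos _)]
    exact mul_le_mul_of_nonneg_right (h.exp_neg_integral_le hs.1.le hs.2 le_rfl hη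
      fun r hr => hy r (Ioo_subset_Icc_self hr)) (abs_nonneg _)
  have hcs := integral_mul_sq_le (k := k) (f := fun t => |g t - (1 - u t ^ 2)|) hL
    ((hkc.pow 2).intervalIntegrable _ _) (by simpa [sq_abs] using hd2) hkd
  simp only [sq_abs] at hcs
  have hC := Real.cosh_pos L
  have hkk : ∫ t in (0 : ℝ)..L, k t ^ 2 ≤ Real.exp (4 * (η * L)) *
      ((1 / 4) * (1 + 3 * L / Real.cosh L ^ 2)) := by
    have e : ∀ t, k t ^ 2 = Real.exp (4 * (η * L)) / Real.cosh L ^ 4 * Real.cosh t ^ 4 := by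
      intro t
      rw [hk]
      simp only
      rw [show 4 * (η * L) = 2 * (η * L) + 2 * (η * L) by ring, Real.exp_add]
      field_simp
    simp only [e]
    rw [intervalIntegral.integral_const_mul]
    refine (mul_le_mul_of_nonneg_left (integral_cosh_pow_four_le hL) (by positivity)).trans
      (le_of_eq ?_)
    field_simp
  calc (u L - Real.tanh L) ^ 2 = |u L - Real.tanh L| ^ 2 := (sq_abs _).symm
    _ ≤ (∫ s in (0 : ℝ)..L, k s * |g s - (1 - u s ^ 2)|) ^ 2 :=
        pow_le_pow_left₀ (abs_nonneg _) hle 2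
    _ ≤ _ := hcs
    _ ≤ _ := mul_le_mul_of_nonneg_right hkk (defect_nonneg hL u g)

end HalfLine

/-! ### Exponential asymptotics of `tanh` and the cost of a boundary -/

theorem one_sub_tanh (t : ℝ) :
    1 - Real.tanh t = 2 * Real.exp (-2 * t) / (1 + Real.exp (-2 * t)) := by
  have h : Real.exp (-2 * t) = Real.exp (-t) * Real.exp (-t) := by
    rw [← Real.exp_add]
    ring_nf
  have h1 : Real.exp t * Real.exp (-t) = 1 := by rw [← Real.exp_add, add_neg_cancel, Real.exp_zero]
  have h2 := Real.exp_pos t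
  have h3 := Real.exp_pos (-t)
  rw [Real.tanh_eq, h]
  field_simp
  linear_combination (-2 * Real.exp (-t)) * h1

theorem one_sub_tanh_le (t : ℝ) : 1 - Real.tanh t ≤ 2 * Real.exp (-2 * t) := by
  rw [one_sub_tanh]
  exact div_le_self (by positivity) (by linarith [Real.exp_pos (-2 * t)])

theorem cosh_sq_eq (t : ℝ) :
    Real.cosh t ^ 2 = (1 + Real.exp (-2 * t)) ^ 2 / (4 * Real.exp (-2 * t)) := by
  have h : Real.exp (-2 * t) = Real.exp (-t) * Real.exp (-t) := by
    rw [← Real.exp_add]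
    ring_nf
  have h1 : Real.exp t * Real.exp (-t) = 1 := by rw [← Real.exp_add, add_neg_cancel, Real.exp_zero]
  have h3 := Real.exp_pos (-t)
  rw [Real.cosh_eq, h, eq_div_iff (by positivity)]
  linear_combination (Real.exp t * Real.exp (-t) + 1 + 2 * Real.exp (-t) ^ 2) * h1

theorem tendsto_exp_neg_two_mul : Tendsto (fun t : ℝ => Real.exp (-2 * t)) atTop (𝓝 0) := by
  refine Real.tendsto_exp_atBot.comp ?_
  exact tendsto_id.const_mul_atTop_of_neg (by norm_num)

theorem tendsto_tanh_atTop : Tendsto Real.tanh atTop (𝓝 1) := by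
  have h : Tendsto (fun t => 1 - 2 * Real.exp (-2 * t)) atTop (𝓝 (1 - 2 * 0)) :=
    (tendsto_exp_neg_two_mul.const_mul 2).const_sub 1
  rw [mul_zero, sub_zero] at h
  exact tendsto_of_tendsto_of_tendsto_of_le_of_le h tendsto_const_nhds
    (fun t => by linarith [one_sub_tanh_le t]) fun t => (Real.tanh_lt_one t).le

theorem tendsto_tanh_atBot : Tendsto Real.tanh atBot (𝓝 (-1)) := by
  have := (tendsto_tanh_atTop.comp tendsto_neg_atBot_atTop).neg
  simpa [Function.comp_def, Real.tanh_neg] using this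

theorem exists_isTranslate (z : ℝ) : ∃ a : Profile, IsTranslate z a :=
  exists_profile (fun t => Real.tanh (t - z)) (continuous_tanh.comp (continuous_sub_right z))
    (tendsto_tanh_atTop.comp (tendsto_atTop_add_const_right _ _ tendsto_id))
    (tendsto_tanh_atBot.comp (tendsto_atBot_add_const_right _ _ tendsto_id))

theorem monotone_tanh : Monotone Real.tanh :=
  monotone_of_deriv_nonneg (fun t => (hasDerivAt_tanh t).differentiableAt) fun t => by
    rw [(hasDerivAt_tanh t).deriv]
    linarith [Real.tanh_sq_lt_one t]

theorem abs_tanh_sub_le (s t : ℝ) : |Real.tanh s - Real.tanh t| ≤ |s - t| := by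
  have := convex_univ.norm_image_sub_le_of_norm_hasDerivWithin_le (C := 1) (s := univ)
    (fun r _ => (hasDerivAt_tanh r).hasDerivWithinAt) (fun r _ => by
      rw [Real.norm_eq_abs, abs_le]
      constructor <;> linarith [Real.tanh_sq_lt_one r, sq_nonneg (Real.tanh r)])
    (mem_univ t) (mem_univ s)
  simpa using this

/-- The correction factor in the lower bound of the cost of a boundary at distance `R`. -/
noncomputable def costFactor (R : ℝ) : ℝ :=
  ((1 + Real.exp (-2 * R)) ^ 2 + 12 * (R * Real.exp (-2 * R)))⁻¹

theorem tendsto_costFactor : Tendsto costFactor atTop (𝓝 1) := by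
  have h1 : Tendsto (fun R : ℝ => R * Real.exp (-2 * R)) atTop (𝓝 0) := by
    have := Real.tendsto_pow_mul_exp_neg_atTop_nhds_zero 1
    have h2 := (this.comp (tendsto_id.const_mul_atTop (show (0 : ℝ) < 2 by norm_num))).const_mul
      (1 / 2)
    rw [mul_zero] at h2
    refine h2.congr fun R => ?_
    simp only [Function.comp_apply, id, pow_one, ← neg_mul]
    ring
  have h2 := (((tendsto_exp_neg_two_mul.const_add 1).pow 2).add (h1.const_mul 12)).inv₀
    (by norm_num)
  norm_num at h2
  exact h2.congr fun R => by simp only [costFactor, neg_mul]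

/-- A bound uniform down to `R = 0` is needed because, before compactness is known, a zero may lie
arbitrarily close to an endpoint `±ℓ`. -/
theorem costFactor_ge {R : ℝ} (hR : 0 ≤ R) : 1 / 10 ≤ costFactor R := by
  have h1 : Real.exp (-2 * R) ≤ 1 := Real.exp_le_one_iff.2 (by linarith)
  have h0 := Real.exp_pos (-2 * R)
  have h2 : R * Real.exp (-2 * R) ≤ 1 / 2 := by
    have h3 := Real.add_one_le_exp (2 * R)
    have h4 : Real.exp (-2 * R) * Real.exp (2 * R) = 1 := by
      rw [← Real.exp_add]
      simp
    nlinarith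
  rw [costFactor, one_div]
  refine inv_anti₀ (by positivity) ?_
  nlinarith

/-- `costFactor` is defined to make this exact: with `q = e^{-2R}` one has `1 - tanh R = 2q/(1 + q)`
and `1/cosh² R = 4q/(1 + q)²`. The cost of a boundary at distance `R` is thus `16 e^{-4R}` to
leading order. -/
theorem one_sub_tanh_sq_eq {R : ℝ} (hR : 0 ≤ R) :
    (1 - Real.tanh R) ^ 2 =
      (16 * Real.exp (-4 * R) * costFactor R) * ((1 / 4) * (1 + 3 * R / Real.cosh R ^ 2)) := by
  have h : Real.exp (-4 * R) = Real.exp (-2 * R) * Real.exp (-2 * R) := by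
    rw [← Real.exp_add]
    ring_nf
  have h0 := Real.exp_pos (-2 * R)
  rw [one_sub_tanh, cosh_sq_eq, costFactor, h]
  generalize Real.exp (-2 * R) = q at *
  have : 0 < (1 + q) ^ 2 + 12 * (R * q) := by positivity
  field_simp
  ring

theorem cost_le_of_sub_tanh_sq_le {R A d : ℝ} (hR : 0 ≤ R)
    (h : (1 - Real.tanh R) ^ 2 ≤
      Real.exp A * ((1 / 4) * (1 + 3 * R / Real.cosh R ^ 2)) * d) :
    Real.exp (-A) * (16 * Real.exp (-4 * R) * costFactor R) ≤ d := by
  have hc : 0 < (1 / 4) * (1 + 3 * R / Real.cosh R ^ 2) := by positivity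
  rw [one_sub_tanh_sq_eq hR] at h
  have h1 : 16 * Real.exp (-4 * R) * costFactor R ≤ Real.exp A * d := by
    refine le_of_mul_le_mul_right ?_ hc
    linarith
  have h2 := mul_le_mul_of_nonneg_left h1 (Real.exp_pos (-A)).le
  rwa [← mul_assoc (Real.exp (-A)) (Real.exp A), ← Real.exp_add, neg_add_cancel, Real.exp_zero,
    one_mul] at h2

/-! ### Lower bound on the whole interval -/

theorem IsSobolev.comp_add_left {a b c : ℝ} {u g : ℝ → ℝ} (h : IsSobolev a b u g)
    (hac : a ≤ c) (hcb : c ≤ b) :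
    IsSobolev 0 (b - c) (fun t => u (c + t)) (fun t => g (c + t)) := by
  have h1 : IsSobolev (c + 0) (c + (b - c)) u g := by
    simpa using h.mono hac hcb le_rfl
  exact ⟨h1.isPrim.comp_add_left c, by simpa using h1.sq_integrable.comp_add_left c⟩

theorem IsSobolev.neg_comp_sub_left {a b c : ℝ} {u g : ℝ → ℝ} (h : IsSobolev a b u g)
    (hac : a ≤ c) (hcb : c ≤ b) :
    IsSobolev 0 (c - a) (fun t => -u (c - t)) (fun t => g (c - t)) := by
  have h1 : IsSobolev (c - (c - a)) (c - 0) u g := by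
    simpa using h.mono le_rfl hac hcb
  exact ⟨h1.isPrim.neg_comp_sub_left c, by simpa using (h1.sq_integrable.comp_sub_left c).symm⟩

theorem integral_comp_shift (F : ℝ → ℝ) (b c : ℝ) :
    ∫ t in (0 : ℝ)..(b - c), F (c + t) = ∫ t in c..b, F t := by
  rw [intervalIntegral.integral_comp_add_left F c]
  simp

theorem integral_comp_reflect (F : ℝ → ℝ) (a c : ℝ) :
    ∫ t in (0 : ℝ)..(c - a), F (c - t) = ∫ t in a..c, F t := by
  rw [intervalIntegral.integral_comp_sub_left F c]
  simp

/-- Lower bound of the defect of a profile with a zero at `z`, and closeness to `tanh(· - z)`. -/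
theorem IsSobolev.estimate {ℓ η z : ℝ} {u g : ℝ → ℝ} (h : IsSobolev (-ℓ) ℓ u g)
    (hz : z ∈ Icc (-ℓ) ℓ) (h0 : u z = 0) (hr : u ℓ = 1) (hl : u (-ℓ) = -1) (hη : 0 < η)
    (hηℓ : η * (2 * ℓ) ≤ 1 / 8) (hf : ∫ t in -ℓ..ℓ, |g t - (1 - u t ^ 2)| ≤ η) :
    (∀ t ∈ Icc (-ℓ) ℓ, |u t - Real.tanh (t - z)| ≤ 2 * η) ∧
      Real.exp (-(4 * (η * (2 * ℓ)))) * (16 * Real.exp (-4 * (ℓ - z)) * costFactor (ℓ - z) +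
        16 * Real.exp (-4 * (ℓ + z)) * costFactor (ℓ + z)) ≤ defect (-ℓ) ℓ u g := by
  have hle : -ℓ ≤ ℓ := hz.1.trans hz.2
  have hd := (h.defect_intervalIntegrable hle).abs
  have hd2 := h.defect_sq_intervalIntegrable hle
  have hmono : ∀ c d, -ℓ ≤ c → c ≤ d → d ≤ ℓ → ∫ t in c..d, |g t - (1 - u t ^ 2)| ≤ η :=
    fun c d h1 h2 h3 => (intervalIntegral.integral_mono_interval h1 h2 h3
      (Eventually.of_forall fun s => abs_nonneg _) hd).trans hf
  -- Both `u(z + ·)` and `-u(z - ·)` start from `0` and end at `1`, so the one-sided estimates apply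
  -- to each, and the two defects add up.
  have hR := h.comp_add_left hz.1 hz.2
  have hS := h.neg_comp_sub_left hz.1 hz.2
  have hR0 : 0 ≤ ℓ - z := by linarith [hz.2]
  have hS0 : 0 ≤ z - -ℓ := by linarith [hz.1]
  have hfR : ∫ t in (0 : ℝ)..(ℓ - z), |g (z + t) - (1 - u (z + t) ^ 2)| ≤ η := by
    rw [integral_comp_shift (fun t => |g t - (1 - u t ^ 2)|)]
    exact hmono _ _ hz.1 hz.2 le_rfl
  have hfS : ∫ t in (0 : ℝ)..(z - -ℓ), |g (z - t) - (1 - (-u (z - t)) ^ 2)| ≤ η := by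
    simp only [neg_sq]
    rw [integral_comp_reflect (fun t => |g t - (1 - u t ^ 2)|)]
    exact hmono _ _ le_rfl hz.1 hz.2
  have hdR : defect 0 (ℓ - z) (fun t => u (z + t)) (fun t => g (z + t)) = defect z ℓ u g :=
    integral_comp_shift (fun t => (g t - (1 - u t ^ 2)) ^ 2) ℓ z
  have hdS : defect 0 (z - -ℓ) (fun t => -u (z - t)) (fun t => g (z - t)) =
      defect (-ℓ) z u g := by
    simp only [defect, neg_sq]
    exact integral_comp_reflect (fun t => (g t - (1 - u t ^ 2)) ^ 2) (-ℓ) z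
  have hηR : η * (ℓ - z) ≤ η * (2 * ℓ) := mul_le_mul_of_nonneg_left (by linarith [hz.1]) hη.le
  have hηS : η * (z - -ℓ) ≤ η * (2 * ℓ) := mul_le_mul_of_nonneg_left (by linarith [hz.2]) hη.le
  have hyR := hR.abs_sub_tanh_lt hR0 (by simpa using h0) hη (by linarith) hfR
  have hyS := hS.abs_sub_tanh_lt hS0 (by simpa using h0) hη (by linarith) hfS
  refine ⟨fun t ht => ?_, ?_⟩
  · rcases le_total z t with hzt | hzt
    · have := hyR (t - z) ⟨by linarith, by linarith [ht.2]⟩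
      rw [add_sub_cancel] at this
      exact this.le
    · have := hyS (z - t) ⟨by linarith, by linarith [ht.1]⟩
      rw [sub_sub_cancel, ← neg_sub t z, Real.tanh_neg, ← abs_neg] at this
      rw [show u t - Real.tanh (t - z) = -(-u t - -Real.tanh (t - z)) by ring]
      exact this.le
  · have hcR := hR.sub_tanh_sq_le hR0 (by simpa using h0) hη.le fun t ht => (hyR t ht).le
    have hcS := hS.sub_tanh_sq_le hS0 (by simpa using h0) hη.le fun t ht => (hyS t ht).le
    simp only [add_sub_cancel, sub_sub_cancel, hr, hl, neg_neg, hdR, hdS] at hcR hcS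
    have h1 := cost_le_of_sub_tanh_sq_le hR0 hcR
    have h2 := cost_le_of_sub_tanh_sq_le hS0 hcS
    have e : z - -ℓ = ℓ + z := by ring
    rw [e] at h2 hηS hS0
    have hsum : defect (-ℓ) z u g + defect z ℓ u g = defect (-ℓ) ℓ u g :=
      intervalIntegral.integral_add_adjacent_intervals
        (hd2.mono_set (by
          rw [uIcc_of_le hle, uIcc_of_le hz.1]; exact Icc_subset_Icc_right hz.2))
        (hd2.mono_set (by
          rw [uIcc_of_le hle, uIcc_of_le hz.2]; exact Icc_subset_Icc_left hz.1))
    rw [← hsum, mul_add, add_comm (defect (-ℓ) z u g)]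
    have hpos : ∀ R, 0 ≤ R → 0 ≤ 16 * Real.exp (-4 * R) * costFactor R := fun R hR => by
      have := costFactor_ge hR
      have := Real.exp_pos (-4 * R)
      exact mul_nonneg (by linarith) (by linarith)
    refine add_le_add (le_trans ?_ h1) (le_trans ?_ h2)
    · exact mul_le_mul_of_nonneg_right (Real.exp_le_exp.2 (by linarith)) (hpos _ hR0)
    · exact mul_le_mul_of_nonneg_right (Real.exp_le_exp.2 (by linarith)) (hpos _ hS0)

/-- A defect of order `e^{-4ℓ}` has `L¹` norm of order `√ℓ e^{-2ℓ}`. The weaker rate `e^{-ℓ}`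
absorbs the power of `ℓ`, and its product with `ℓ` still vanishes in the limit; `C + 1` keeps the
bound positive. -/
theorem mul_two_mul_le_of_exp {ℓ C D : ℝ} (hℓ : 0 < ℓ) (hC : 0 ≤ C)
    (hD : Real.exp (4 * ℓ) * ((1 / 2) * D) ≤ C) :
    (ℓ - -ℓ) * D ≤ (2 * (C + 1) * Real.exp (-ℓ)) ^ 2 := by
  have h1 : Real.exp (4 * ℓ) * Real.exp (-(4 * ℓ)) = 1 := by
    rw [← Real.exp_add, add_neg_cancel, Real.exp_zero]
  have h2 : D ≤ 2 * C * Real.exp (-(4 * ℓ)) := by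
    have h := mul_le_mul_of_nonneg_right hD (Real.exp_pos (-(4 * ℓ))).le
    have e : Real.exp (4 * ℓ) * ((1 / 2) * D) * Real.exp (-(4 * ℓ)) = (1 / 2) * D := by
      linear_combination ((1 / 2) * D) * h1
    linarith
  have h3 : ℓ * Real.exp (-(4 * ℓ)) ≤ Real.exp (-ℓ) ^ 2 := by
    have e : Real.exp (-ℓ) ^ 2 = Real.exp (2 * ℓ) * Real.exp (-(4 * ℓ)) := by
      rw [← Real.exp_nat_mul, ← Real.exp_add]
      congr 1
      push_cast
      ring
    rw [e]
    refine mul_le_mul_of_nonneg_right ?_ (Real.exp_pos _).le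
    linarith [Real.add_one_le_exp (2 * ℓ)]
  have h4 : (ℓ - -ℓ) * D ≤ (2 * ℓ) * (2 * C * Real.exp (-(4 * ℓ))) := by
    rw [sub_neg_eq_add, ← two_mul]
    exact mul_le_mul_of_nonneg_left h2 (by linarith)
  have h5 : (4 * C) * (ℓ * Real.exp (-(4 * ℓ))) ≤ (4 * C) * Real.exp (-ℓ) ^ 2 :=
    mul_le_mul_of_nonneg_left h3 (by linarith)
  have h6 : (4 * C) * Real.exp (-ℓ) ^ 2 ≤ (2 * (C + 1)) ^ 2 * Real.exp (-ℓ) ^ 2 :=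
    mul_le_mul_of_nonneg_right (by nlinarith) (sq_nonneg _)
  rw [mul_pow]
  linarith

/-- Profiles in `𝒳_ℓ` that are close to `tanh(· - z)` on `[-ℓ, ℓ]` are close to it everywhere. -/
theorem abs_sub_tanh_le_of_boundarySet {ℓ z δ : ℝ} (hℓ : 0 < ℓ) {x : Profile}
    (hx : x ∈ boundarySet ℓ) (h : ∀ t ∈ Icc (-ℓ) ℓ, |x.1 t - Real.tanh (t - z)| ≤ δ) (t : ℝ) :
    |x.1 t - Real.tanh (t - z)| ≤ δ := by
  obtain ⟨hr, hl⟩ := boundarySet_apply hℓ hx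
  by_cases ht : |t| ≤ ℓ
  · exact h t (abs_le.1 ht)
  · have ht' := (not_le.1 ht)
    have h1 := h ℓ ⟨by linarith, le_rfl⟩
    have h2 := h (-ℓ) ⟨le_rfl, by linarith⟩
    rw [hr] at h1
    rw [hl] at h2
    rw [hx t ht'.le]
    -- Outside the interval the profile is constant and equal to the limit that `tanh` approaches
    -- monotonically, so the error is at most that at the endpoint.
    rcases lt_abs.1 ht' with h3 | h3
    · rw [Real.sign_of_pos (by linarith)]
      have h4 := monotone_tanh (show ℓ - z ≤ t - z by linarith)
      have h5 := Real.tanh_lt_one (t - z)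
      rw [abs_of_nonneg (by linarith)]
      linarith [le_abs_self (1 - Real.tanh (ℓ - z))]
    · rw [Real.sign_of_neg (by linarith)]
      have h4 := monotone_tanh (show t - z ≤ -ℓ - z by linarith)
      have h5 := Real.neg_one_lt_tanh (t - z)
      rw [abs_of_nonpos (by linarith)]
      linarith [neg_abs_le (-1 - Real.tanh (-ℓ - z))]

theorem tendsto_of_abs_sub_le {x : ℕ → Profile} {a : Profile} {δ : ℕ → ℝ}
    (hδ : Tendsto δ atTop (𝓝 0)) (h : ∀ᶠ n in atTop, ∀ t, |(x n).1 t - a.1 t| ≤ δ n) :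
    Tendsto x atTop (𝓝 a) := by
  rw [tendsto_iff_dist_tendsto_zero]
  refine squeeze_zero' (Eventually.of_forall fun n => dist_nonneg) ?_ hδ
  filter_upwards [h] with n hn
  rw [Subtype.dist_eq]
  exact (BoundedContinuousFunction.dist_le ((abs_nonneg _).trans (hn 0))).2 fun t => by
    rw [Real.dist_eq]
    exact hn t

/-! ### Compactness of profiles with bounded cost -/

/-- Compactness and lower bound: if the excess over `4/3` of the free energies of `x n`, multiplied
by `exp (4 L n)`, is asymptotically at most `β`, then a subsequence converges to a translate of
`tanh`, whose position is controlled by `β`. -/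
theorem exists_subseq_tendsto {L : ℕ → ℝ} (hL0 : ∀ n, 0 < L n) (hL : Tendsto L atTop atTop)
    {x : ℕ → Profile} (hx : ∀ n, x n ∈ boundarySet (L n)) {g : ℕ → ℝ → ℝ}
    (hg : ∀ n, IsSobolev (-L n) (L n) (x n).1 (g n)) {B : ℕ → ℝ} {β : ℝ}
    (hB : ∀ n, Real.exp (4 * L n) * ((1 / 2) * defect (-L n) (L n) (x n).1 (g n)) ≤ B n)
    (hβ : Tendsto B atTop (𝓝 β)) :
    ∃ (z : ℝ) (a : Profile) (k : ℕ → ℕ), IsTranslate z a ∧ StrictMono k ∧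
      Tendsto (fun j => x (k j)) atTop (𝓝 a) ∧ 16 * Real.cosh (4 * z) ≤ β := by
  obtain ⟨C, hC⟩ := hβ.bddAbove_range
  have hBC : ∀ n, B n ≤ C := fun n => hC (mem_range_self n)
  have hC0 : 0 ≤ C := by
    refine le_trans ?_ ((hB 0).trans (hBC 0))
    have := defect_nonneg (show -L 0 ≤ L 0 by linarith [hL0 0]) (x 0).1 (g 0)
    positivity
  have hzero : ∀ n, ∃ z ∈ Icc (-L n) (L n), (x n).1 z = 0 := fun n => by
    obtain ⟨hr, hl⟩ := boundarySet_apply (hL0 n) (hx n)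
    have := intermediate_value_Icc (show -L n ≤ L n by linarith [hL0 n])
      (x n).1.continuous.continuousOn
    obtain ⟨z, hz, h0⟩ := this (show (0 : ℝ) ∈ Icc ((x n).1 (-L n)) ((x n).1 (L n)) by
      rw [hr, hl]; constructor <;> norm_num)
    exact ⟨z, hz, h0⟩
  choose ζ hζ hζ0 using hzero
  set η : ℕ → ℝ := fun n => 2 * (C + 1) * Real.exp (-L n) with hη
  have hηpos : ∀ n, 0 < η n := fun n => by positivity
  have hη0 : Tendsto η atTop (𝓝 0) := by
    have := (Real.tendsto_exp_neg_atTop_nhds_zero.comp hL).const_mul (2 * (C + 1))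
    rwa [mul_zero] at this
  have hηL : Tendsto (fun n => η n * (2 * L n)) atTop (𝓝 0) := by
    have := ((Real.tendsto_pow_mul_exp_neg_atTop_nhds_zero 1).comp hL).const_mul (4 * (C + 1))
    rw [mul_zero] at this
    refine this.congr fun n => ?_
    simp only [hη, Function.comp_apply, pow_one]
    ring
  have hsmall : ∀ᶠ n in atTop, η n * (2 * L n) ≤ 1 / 8 :=
    hηL.eventually (ge_mem_nhds (by norm_num))
  have hf : ∀ n, ∫ t in -L n..L n, |g n t - (1 - (x n).1 t ^ 2)| ≤ η n := fun n => by
    have hle : -L n ≤ L n := by linarith [hL0 n]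
    refine le_of_sq_le_sq ?_ (hηpos n).le
    exact ((hg n).integral_abs_sq_le hle).trans
      (mul_two_mul_le_of_exp (hL0 n) hC0 ((hB n).trans (hBC n)))
  have hest : ∀ᶠ n in atTop, (∀ t, |(x n).1 t - Real.tanh (t - ζ n)| ≤ 2 * η n) ∧
      Real.exp (-(4 * (η n * (2 * L n)))) * (8 * (Real.exp (4 * ζ n) * costFactor (L n - ζ n) +
        Real.exp (-(4 * ζ n)) * costFactor (L n + ζ n))) ≤ B n := by
    filter_upwards [hsmall] with n hn
    obtain ⟨hr, hl⟩ := boundarySet_apply (hL0 n) (hx n)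
    obtain ⟨h1, h2⟩ := (hg n).estimate (hζ n) (hζ0 n) hr hl (hηpos n) hn (hf n)
    refine ⟨abs_sub_tanh_le_of_boundarySet (hL0 n) (hx n) h1, le_trans ?_ (hB n)⟩
    have h3 := mul_le_mul_of_nonneg_left h2
      (show 0 ≤ Real.exp (4 * L n) * (1 / 2) by positivity)
    refine le_trans (le_of_eq ?_) (h3.trans (le_of_eq (by ring)))
    have e1 : Real.exp (4 * ζ n) = Real.exp (4 * L n) * Real.exp (-4 * (L n - ζ n)) := by
      rw [← Real.exp_add]
      ring_nf
    have e2 : Real.exp (-(4 * ζ n)) = Real.exp (4 * L n) * Real.exp (-4 * (L n + ζ n)) := by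
      rw [← Real.exp_add]
      ring_nf
    rw [e1, e2]
    ring
  -- Each exponential `e^{±4ζ}` is at most `5C/2`, which confines the zeros; `3C` is a generous
  -- radius.
  have hbdd : ∀ᶠ n in atTop, ζ n ∈ Icc (-(3 * C)) (3 * C) := by
    filter_upwards [hest, hsmall] with n h1 h2
    have h3 := h1.2.trans (hBC n)
    have hR := costFactor_ge (R := L n - ζ n) (by linarith [(hζ n).2])
    have hS := costFactor_ge (R := L n + ζ n) (by linarith [(hζ n).1])
    have h4 : 1 / 2 ≤ Real.exp (-(4 * (η n * (2 * L n)))) := by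
      have := Real.add_one_le_exp (-(4 * (η n * (2 * L n))))
      linarith
    have e1 := Real.exp_pos (4 * ζ n)
    have e2 := Real.exp_pos (-(4 * ζ n))
    have h5 : (8 / 10) * (Real.exp (4 * ζ n) + Real.exp (-(4 * ζ n))) ≤
        8 * (Real.exp (4 * ζ n) * costFactor (L n - ζ n) +
          Real.exp (-(4 * ζ n)) * costFactor (L n + ζ n)) := by
      nlinarith
    have h6 : (1 / 2) * ((8 / 10) * (Real.exp (4 * ζ n) + Real.exp (-(4 * ζ n)))) ≤ C :=
      (mul_le_mul h4 h5 (by positivity) (Real.exp_pos _).le).trans h3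
    have h7 := Real.add_one_le_exp (4 * ζ n)
    have h8 := Real.add_one_le_exp (-(4 * ζ n))
    constructor <;> linarith
  obtain ⟨z, -, k, hk, hz⟩ := isCompact_Icc.tendsto_subseq' hbdd.frequently
  obtain ⟨a, ha⟩ := exists_isTranslate z
  have hkt := hk.tendsto_atTop
  refine ⟨z, a, k, ha, hk, ?_, ?_⟩
  · have hz' : Tendsto (fun j => |ζ (k j) - z|) atTop (𝓝 0) := by
      have := (hz.sub_const z).abs
      simpa using this
    refine tendsto_of_abs_sub_le (δ := fun j => 2 * η (k j) + |ζ (k j) - z|) ?_ ?_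
    · have := ((hη0.comp hkt).const_mul 2).add hz'
      simpa using this
    · filter_upwards [hkt.eventually hest] with j hj t
      rw [ha t]
      have h1 := hj.1 t
      have h2 := abs_tanh_sub_le (t - ζ (k j)) (t - z)
      rw [show t - ζ (k j) - (t - z) = -(ζ (k j) - z) by ring, abs_neg] at h2
      calc |(x (k j)).1 t - Real.tanh (t - z)|
          ≤ |(x (k j)).1 t - Real.tanh (t - ζ (k j))| +
            |Real.tanh (t - ζ (k j)) - Real.tanh (t - z)| := abs_sub_le _ _ _
        _ ≤ _ := add_le_add h1 h2
  -- Once the zeros converge, both distances to the endpoints diverge and all correction factors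
  -- tend to `1`; the limit of the lower bound is `8 (e^{4z} + e^{-4z})`.
  · have hLk := hL.comp hkt
    have hR : Tendsto (fun j => costFactor (L (k j) - ζ (k j))) atTop (𝓝 1) :=
      tendsto_costFactor.comp (by simpa [sub_eq_add_neg] using hLk.atTop_add hz.neg)
    have hS : Tendsto (fun j => costFactor (L (k j) + ζ (k j))) atTop (𝓝 1) :=
      tendsto_costFactor.comp (hLk.atTop_add hz)
    have hE : Tendsto (fun j => Real.exp (-(4 * (η (k j) * (2 * L (k j)))))) atTop (𝓝 1) := by
      have := (((hηL.comp hkt).const_mul 4).neg).rexp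
      simpa using this
    have h1 : Tendsto (fun j => Real.exp (4 * ζ (k j))) atTop (𝓝 (Real.exp (4 * z))) :=
      (hz.const_mul 4).rexp
    have h2 : Tendsto (fun j => Real.exp (-(4 * ζ (k j)))) atTop (𝓝 (Real.exp (-(4 * z)))) :=
      (hz.const_mul 4).neg.rexp
    have hlim := hE.mul (((h1.mul hR).add (h2.mul hS)).const_mul 8)
    have := le_of_tendsto_of_tendsto hlim (hβ.comp hkt)
      ((hkt.eventually hest).mono fun j hj => hj.2)
    rw [Real.cosh_eq]
    linarith

/-! ### Recovery sequence -/

theorem exists_profile_of_eqOn {ℓ : ℝ} (hℓ : 0 < ℓ) {u g : ℝ → ℝ} (hu : Continuous u)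
    (hg : IsSobolev (-ℓ) ℓ u g) (hr : u ℓ = 1) (hl : u (-ℓ) = -1) :
    ∃ x ∈ boundarySet ℓ, EqOn u x.1 (Icc (-ℓ) ℓ) ∧ IsSobolev (-ℓ) ℓ x.1 g := by
  have hge : ∀ t, ℓ ≤ t → u (max (-ℓ) (min ℓ t)) = 1 := fun t ht => by
    rw [min_eq_left ht, max_eq_right (by linarith), hr]
  have hle : ∀ t, t ≤ -ℓ → u (max (-ℓ) (min ℓ t)) = -1 := fun t ht => by
    rw [min_eq_right (by linarith), max_eq_left ht, hl]
  obtain ⟨x, hx⟩ := exists_profile (fun t => u (max (-ℓ) (min ℓ t))) (by fun_prop)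
    (tendsto_const_nhds.congr' (by
      filter_upwards [eventually_ge_atTop ℓ] with t ht using (hge t ht).symm))
    (tendsto_const_nhds.congr' (by
      filter_upwards [eventually_le_atBot (-ℓ)] with t ht using (hle t ht).symm))
  have hux : EqOn u x.1 (Icc (-ℓ) ℓ) := fun t ht => by
    rw [hx, min_eq_right ht.2, max_eq_right ht.1]
  refine ⟨x, fun t ht => ?_, hux, hg.congr (by linarith) hux⟩
  rw [hx]
  rcases le_abs.1 ht with h1 | h1
  · rw [hge t h1, Real.sign_of_pos (by linarith)]
  · rw [hle t (by linarith), Real.sign_of_neg (by linarith)]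

/-- The factor `exp (4ℓ) / (2 sinh (4ℓ))` in the estimates of the recovery sequence. -/
noncomputable def expSinhRatio (ℓ : ℝ) : ℝ := (1 - Real.exp (-8 * ℓ))⁻¹

theorem tendsto_expSinhRatio : Tendsto expSinhRatio atTop (𝓝 1) := by
  have h1 : Tendsto (fun t : ℝ => Real.exp (-8 * t)) atTop (𝓝 0) :=
    Real.tendsto_exp_atBot.comp (tendsto_id.const_mul_atTop_of_neg (by norm_num))
  have := (h1.const_sub 1).inv₀ (by norm_num)
  rw [sub_zero, inv_one] at this
  exact this

theorem expSinhRatio_pos {ℓ : ℝ} (hℓ : 0 < ℓ) : 0 < expSinhRatio ℓ :=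
  inv_pos.2 (sub_pos.2 (Real.exp_lt_one_iff.2 (by linarith)))

theorem inv_two_sinh {ℓ : ℝ} (hℓ : 0 < ℓ) :
    (2 * Real.sinh (4 * ℓ))⁻¹ = expSinhRatio ℓ * Real.exp (-(4 * ℓ)) := by
  have h1 : Real.exp (4 * ℓ) * Real.exp (-(4 * ℓ)) = 1 := by
    rw [← Real.exp_add, add_neg_cancel, Real.exp_zero]
  have h2 : Real.exp (-8 * ℓ) = Real.exp (-(4 * ℓ)) * Real.exp (-(4 * ℓ)) := by
    rw [← Real.exp_add]
    ring_nf
  have h3 : 0 < 1 - Real.exp (-8 * ℓ) := sub_pos.2 (Real.exp_lt_one_iff.2 (by linarith))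
  have h4 : 0 < Real.sinh (4 * ℓ) := Real.sinh_pos_iff.2 (by linarith)
  rw [expSinhRatio, inv_mul_eq_div, inv_eq_one_div, div_eq_div_iff (by positivity) h3.ne',
    Real.sinh_eq, h2]
  linear_combination -h1

/-- Algebraic estimate of the defect `y' + 2 w y + y²` of a perturbation of `tanh`. -/
theorem defect_perturbation_bounds {a b p q w s : ℝ} (ha : 0 ≤ a) (hb : 0 ≤ b) (hp : 0 ≤ p)
    (hq : 0 ≤ q) (hw : |w| ≤ 1) (hs : 0 < s) :
    |(a * Real.sinh p - b * Real.sinh q) / s| ≤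
        (a * Real.exp p + b * Real.exp q) * (2 * s)⁻¹ ∧
      0 ≤ (2 * a * Real.cosh p + 2 * b * Real.cosh q) / s +
        2 * w * ((a * Real.sinh p - b * Real.sinh q) / s) ∧
      (2 * a * Real.cosh p + 2 * b * Real.cosh q) / s +
        2 * w * ((a * Real.sinh p - b * Real.sinh q) / s) ≤
        4 * ((a * Real.exp p + b * Real.exp q) * (2 * s)⁻¹) := by
  have hsp := Real.sinh_nonneg_iff.2 hp
  have hsq := Real.sinh_nonneg_iff.2 hq
  have ep : Real.sinh p ≤ Real.exp p / 2 := by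
    rw [Real.sinh_eq]; linarith [Real.exp_pos (-p)]
  have eq : Real.sinh q ≤ Real.exp q / 2 := by
    rw [Real.sinh_eq]; linarith [Real.exp_pos (-q)]
  have cp := Real.sinh_lt_cosh p
  have cq := Real.sinh_lt_cosh q
  have fp : Real.cosh p + Real.sinh p = Real.exp p := Real.cosh_add_sinh p
  have fq : Real.cosh q + Real.sinh q = Real.exp q := Real.cosh_add_sinh q
  obtain ⟨w1, w2⟩ := abs_le.1 hw
  have hwp : |w * Real.sinh p| ≤ Real.sinh p := by
    rw [abs_mul, abs_of_nonneg hsp]; nlinarith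
  have hwq : |w * Real.sinh q| ≤ Real.sinh q := by
    rw [abs_mul, abs_of_nonneg hsq]; nlinarith
  obtain ⟨wp1, wp2⟩ := abs_le.1 hwp
  obtain ⟨wq1, wq2⟩ := abs_le.1 hwq
  have e : (2 * a * Real.cosh p + 2 * b * Real.cosh q) / s +
      2 * w * ((a * Real.sinh p - b * Real.sinh q) / s) =
      (2 * (a * (Real.cosh p + w * Real.sinh p)) + 2 * (b * (Real.cosh q - w * Real.sinh q))) / s :=
    by ring
  have e2 : 4 * ((a * Real.exp p + b * Real.exp q) * (2 * s)⁻¹) =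
      (2 * (a * Real.exp p) + 2 * (b * Real.exp q)) / s := by
    field_simp
    ring
  have e3 : (a * Real.exp p + b * Real.exp q) * (2 * s)⁻¹ =
      (a * (Real.exp p / 2) + b * (Real.exp q / 2)) / s := by
    field_simp
  rw [e, e2, e3]
  refine ⟨?_, ?_, ?_⟩
  · rw [abs_div, abs_of_pos hs]
    refine div_le_div_of_nonneg_right (abs_le.2 ⟨?_, ?_⟩) hs.le <;>
      nlinarith [mul_nonneg ha hsp, mul_nonneg hb hsq, mul_le_mul_of_nonneg_left ep ha,
        mul_le_mul_of_nonneg_left eq hb]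
  · refine div_nonneg (add_nonneg ?_ ?_) hs.le
    · exact mul_nonneg zero_le_two (mul_nonneg ha (by linarith))
    · exact mul_nonneg zero_le_two (mul_nonneg hb (by linarith))
  · refine div_le_div_of_nonneg_right (add_le_add ?_ ?_) hs.le
    · exact mul_le_mul_of_nonneg_left (mul_le_mul_of_nonneg_left (by linarith) ha) zero_le_two
    · exact mul_le_mul_of_nonneg_left (mul_le_mul_of_nonneg_left (by linarith) hb) zero_le_two

theorem integral_sq_exp_add_exp (α β ℓ : ℝ) :
    ∫ t in -ℓ..ℓ, (α * Real.exp (2 * t) + β * Real.exp (-2 * t)) ^ 2 =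
      (α ^ 2 + β ^ 2) / 4 * (Real.exp (4 * ℓ) - Real.exp (-(4 * ℓ))) + 4 * α * β * ℓ := by
  have hd : ∀ t : ℝ, HasDerivAt (fun t => α ^ 2 / 4 * Real.exp (4 * t) + 2 * α * β * t -
      β ^ 2 / 4 * Real.exp (-4 * t))
      ((α * Real.exp (2 * t) + β * Real.exp (-2 * t)) ^ 2) t := fun t => by
    have h := ((((((hasDerivAt_id t).const_mul 4).exp).const_mul (α ^ 2 / 4)).add
      ((hasDerivAt_id t).const_mul (2 * α * β))).sub
      ((((hasDerivAt_id t).const_mul (-4)).exp).const_mul (β ^ 2 / 4)))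
    convert! h using 1
    have e1 : Real.exp (4 * t) = Real.exp (2 * t) * Real.exp (2 * t) := by
      rw [← Real.exp_add]; ring_nf
    have e2 : Real.exp (-4 * t) = Real.exp (-2 * t) * Real.exp (-2 * t) := by
      rw [← Real.exp_add]; ring_nf
    have e3 : Real.exp (2 * t) * Real.exp (-2 * t) = 1 := by
      rw [← Real.exp_add]; simp
    simp only [id]
    rw [e1, e2]
    linear_combination (2 * α * β) * e3
  rw [intervalIntegral.integral_eq_sub_of_hasDerivAt (fun t _ => hd t)
    (by apply Continuous.intervalIntegrable; fun_prop)]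
  rw [show (4 : ℝ) * -ℓ = -(4 * ℓ) by ring, show (-4 : ℝ) * -ℓ = 4 * ℓ by ring,
    show (-4 : ℝ) * ℓ = -(4 * ℓ) by ring]
  ring

/-- Recovery sequence: `tanh(· - z)` corrected by a solution of the equation linearized at the
wells. -/
theorem exists_recovery (z : ℝ) : ∃ B δ : ℝ → ℝ,
    Tendsto B atTop (𝓝 (16 * Real.cosh (4 * z))) ∧ Tendsto δ atTop (𝓝 0) ∧
    ∀ ℓ, 0 < ℓ → ∃ x ∈ boundarySet ℓ, ∃ g, IsSobolev (-ℓ) ℓ x.1 g ∧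
      (∀ t, |x.1 t - Real.tanh (t - z)| ≤ δ ℓ) ∧
      Real.exp (4 * ℓ) * ((1 / 2) * defect (-ℓ) ℓ x.1 g) ≤ B ℓ := by
  -- `α e^{-2ℓ}` and `β e^{-2ℓ}` are the leading terms of the gaps `1 - tanh(ℓ ∓ z)` to be closed at
  -- the two endpoints.
  set α := 2 * Real.exp (2 * z) with hα
  set β := 2 * Real.exp (-2 * z) with hβ
  have hα0 : 0 < α := by positivity
  have hβ0 : 0 < β := by positivity
  have hαβ : α * β = 4 := by
    have : Real.exp (2 * z) * Real.exp (-2 * z) = 1 := by rw [← Real.exp_add]; simp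
    rw [hα, hβ]
    linear_combination 4 * this
  have hsq : α ^ 2 + β ^ 2 = 8 * Real.cosh (4 * z) := by
    have e1 : Real.exp (4 * z) = Real.exp (2 * z) * Real.exp (2 * z) := by
      rw [← Real.exp_add]; ring_nf
    have e2 : Real.exp (-(4 * z)) = Real.exp (-2 * z) * Real.exp (-2 * z) := by
      rw [← Real.exp_add]; ring_nf
    rw [Real.cosh_eq, e1, e2, hα, hβ]
    ring
  set δ : ℝ → ℝ := fun ℓ => expSinhRatio ℓ * Real.exp (-2 * ℓ) * (α + β) with hδ
  have hδ0 : Tendsto δ atTop (𝓝 0) := by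
    have := (tendsto_expSinhRatio.mul tendsto_exp_neg_two_mul).mul_const (α + β)
    rwa [mul_zero, zero_mul] at this
  refine ⟨fun ℓ => (1 / 2) * (4 + δ ℓ) ^ 2 * (expSinhRatio ℓ ^ 2 *
    (2 * Real.cosh (4 * z) + 4 * ((4 * ℓ) ^ 1 * Real.exp (-(4 * ℓ))))), δ, ?_, hδ0, ?_⟩
  · have h1 : Tendsto (fun ℓ : ℝ => (4 * ℓ) ^ 1 * Real.exp (-(4 * ℓ))) atTop (𝓝 0) :=
      (Real.tendsto_pow_mul_exp_neg_atTop_nhds_zero 1).comp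
        (tendsto_id.const_mul_atTop (by norm_num))
    have := (((hδ0.const_add 4).pow 2).const_mul (1 / 2)).mul ((tendsto_expSinhRatio.pow 2).mul
      ((h1.const_mul 4).const_add (2 * Real.cosh (4 * z))))
    convert! this using 2
    ring
  intro ℓ hℓ
  have hle : -ℓ ≤ ℓ := by linarith
  set s := Real.sinh (4 * ℓ) with hs
  have hs0 : 0 < s := Real.sinh_pos_iff.2 (by linarith)
  set a := 1 - Real.tanh (ℓ - z) with ha
  set b := 1 - Real.tanh (ℓ + z) with hb
  have ha0 : 0 ≤ a := by linarith [Real.tanh_lt_one (ℓ - z)]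
  have hb0 : 0 ≤ b := by linarith [Real.tanh_lt_one (ℓ + z)]
  have haα : a ≤ α * Real.exp (-2 * ℓ) := by
    have := one_sub_tanh_le (ℓ - z)
    rw [hα, mul_assoc, ← Real.exp_add]
    convert! this using 3
    ring
  have hbβ : b ≤ β * Real.exp (-2 * ℓ) := by
    have := one_sub_tanh_le (ℓ + z)
    rw [hβ, mul_assoc, ← Real.exp_add]
    convert! this using 3
    ring
  -- The solution of `y'' = 4y` with `y(ℓ) = a` and `y(-ℓ) = -b`; it restores the boundary values
  -- `±1`.
  set y : ℝ → ℝ := fun t => (a * Real.sinh (2 * (ℓ + t)) - b * Real.sinh (2 * (ℓ - t))) / s with hy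
  set y' : ℝ → ℝ := fun t =>
    (2 * a * Real.cosh (2 * (ℓ + t)) + 2 * b * Real.cosh (2 * (ℓ - t))) / s with hy'
  set u : ℝ → ℝ := fun t => Real.tanh (t - z) + y t with hu
  set g : ℝ → ℝ := fun t => (1 - Real.tanh (t - z) ^ 2) + y' t with hg
  have hyd : ∀ t, HasDerivAt y (y' t) t := fun t => by
    have h1 := ((((hasDerivAt_id t).const_add ℓ).const_mul 2).sinh).const_mul a
    have h2 := ((((hasDerivAt_id t).const_sub ℓ).const_mul 2).sinh).const_mul b
    convert! (h1.sub h2).div_const s using 1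
    simp only [hy', id]
    ring
  have hud : ∀ t, HasDerivAt u (g t) t := fun t =>
    ((hasDerivAt_tanh (t - z)).comp_sub_const t z).add (hyd t)
  have htanh := continuous_tanh
  have hgc : Continuous g := by fun_prop
  have huc : Continuous u := continuous_iff_continuousAt.2 fun t => (hud t).continuousAt
  have hur : u ℓ = 1 := by
    simp only [hu, hy]
    rw [sub_self, mul_zero, Real.sinh_zero, mul_zero, sub_zero,
      show 2 * (ℓ + ℓ) = 4 * ℓ by ring, mul_div_assoc, ← hs, div_self hs0.ne', ha]
    ring
  have hul : u (-ℓ) = -1 := by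
    simp only [hu, hy]
    rw [add_neg_cancel, mul_zero, Real.sinh_zero, mul_zero, zero_sub,
      show 2 * (ℓ - -ℓ) = 4 * ℓ by ring, ← hs, neg_div, mul_div_assoc, div_self hs0.ne', hb,
      show -ℓ - z = -(ℓ + z) by ring, Real.tanh_neg]
    ring
  obtain ⟨x, hx, hux, hxg⟩ := exists_profile_of_eqOn hℓ huc
    (IsSobolev.of_hasDerivAt hud hgc) hur hul
  set κ := expSinhRatio ℓ with hκ
  have hκ0 : 0 < κ := expSinhRatio_pos hℓ
  -- An explicit majorant of `|y|`; the linear part `y' + 2 tanh(· - z) y` of the defect is at most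
  -- `4A`.
  set A : ℝ → ℝ := fun t => κ * Real.exp (-(4 * ℓ)) *
    (α * Real.exp (2 * t) + β * Real.exp (-2 * t)) with hA
  have hA0 : ∀ t, 0 ≤ A t := fun t => by positivity
  have hAle : ∀ t, (a * Real.exp (2 * (ℓ + t)) + b * Real.exp (2 * (ℓ - t))) * (2 * s)⁻¹ ≤ A t := by
    intro t
    rw [hs, inv_two_sinh hℓ, mul_comm]
    refine mul_le_mul_of_nonneg_left (add_le_add ?_ ?_) (by positivity)
    · refine (mul_le_mul_of_nonneg_right haα (Real.exp_pos _).le).trans (le_of_eq ?_)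
      rw [mul_assoc, ← Real.exp_add]
      ring_nf
    · refine (mul_le_mul_of_nonneg_right hbβ (Real.exp_pos _).le).trans (le_of_eq ?_)
      rw [mul_assoc, ← Real.exp_add]
      ring_nf
  have hAδ : ∀ t ∈ Icc (-ℓ) ℓ, A t ≤ δ ℓ := by
    intro t ht
    have e : Real.exp (-2 * ℓ) = Real.exp (-(4 * ℓ)) * Real.exp (2 * ℓ) := by
      rw [← Real.exp_add]
      ring_nf
    have h1 : Real.exp (2 * t) ≤ Real.exp (2 * ℓ) := Real.exp_le_exp.2 (by linarith [ht.2])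
    have h2 : Real.exp (-2 * t) ≤ Real.exp (2 * ℓ) := Real.exp_le_exp.2 (by linarith [ht.1])
    have h3 : A t ≤ κ * Real.exp (-(4 * ℓ)) * (α * Real.exp (2 * ℓ) + β * Real.exp (2 * ℓ)) := by
      simp only [hA]
      gcongr
    refine h3.trans (le_of_eq ?_)
    simp only [hδ]
    rw [e]
    ring
  have hbounds : ∀ t ∈ Icc (-ℓ) ℓ, |y t| ≤ A t ∧
      (g t - (1 - u t ^ 2)) ^ 2 ≤ (4 + δ ℓ) ^ 2 * A t ^ 2 := by
    intro t ht
    obtain ⟨h1, h2, h3⟩ := defect_perturbation_bounds ha0 hb0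
      (show 0 ≤ 2 * (ℓ + t) by linarith [ht.1]) (show 0 ≤ 2 * (ℓ - t) by linarith [ht.2])
      (Real.abs_tanh_lt_one (t - z)).le hs0
    have hyA : |y t| ≤ A t := h1.trans (hAle t)
    have h3' := h3.trans (mul_le_mul_of_nonneg_left (hAle t) zero_le_four)
    have hAt := hAδ t ht
    have hy2 : y t ^ 2 ≤ δ ℓ * A t := by
      rw [← sq_abs]
      nlinarith [abs_nonneg (y t)]
    -- The linear part lies between `0` and `4A` and the quadratic part is at most `δ A`, so the
    -- constant `4` only becomes `4 + δ`. Nonnegativity allows squaring the upper bound.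
    have e : g t - (1 - u t ^ 2) = (y' t + 2 * Real.tanh (t - z) * y t) + y t ^ 2 := by
      simp only [hg, hu]
      ring
    refine ⟨hyA, ?_⟩
    rw [e, ← mul_pow]
    refine pow_le_pow_left₀ (add_nonneg h2 (sq_nonneg _)) ?_ 2
    linarith
  refine ⟨x, hx, g, hxg, abs_sub_tanh_le_of_boundarySet hℓ hx fun t ht => ?_, ?_⟩
  · rw [← hux ht]
    simp only [hu, add_sub_cancel_left]
    exact (hbounds t ht).1.trans (hAδ t ht)
  · have hAc : Continuous A := by fun_prop
    have h1 : defect (-ℓ) ℓ x.1 g ≤ ∫ t in -ℓ..ℓ, (4 + δ ℓ) ^ 2 * A t ^ 2 := by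
      refine intervalIntegral.integral_mono_on hle (hxg.defect_sq_intervalIntegrable hle)
        (by apply Continuous.intervalIntegrable; fun_prop) fun t ht => ?_
      rw [← hux ht]
      exact (hbounds t ht).2
    have h2 : ∫ t in -ℓ..ℓ, (4 + δ ℓ) ^ 2 * A t ^ 2 = (4 + δ ℓ) ^ 2 *
        ((κ * Real.exp (-(4 * ℓ))) ^ 2 * (2 * Real.cosh (4 * z) *
          (Real.exp (4 * ℓ) - Real.exp (-(4 * ℓ))) + 16 * ℓ)) := by
      rw [intervalIntegral.integral_const_mul]
      simp only [hA, mul_pow]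
      rw [intervalIntegral.integral_const_mul, integral_sq_exp_add_exp, hsq]
      congr 2
      linear_combination (4 * ℓ) * hαβ
    rw [h2] at h1
    have e : Real.exp (4 * ℓ) * Real.exp (-(4 * ℓ)) = 1 := by
      rw [← Real.exp_add, add_neg_cancel, Real.exp_zero]
    have h3 := mul_le_mul_of_nonneg_left h1
      (show 0 ≤ Real.exp (4 * ℓ) * (1 / 2) by positivity)
    rw [mul_assoc] at h3
    refine h3.trans ?_
    beta_reduce
    rw [← hκ]
    have hX := Real.exp_pos (-(4 * ℓ))
    have hcosh := Real.cosh_pos (4 * z)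
    generalize Real.exp (-(4 * ℓ)) = X at *
    generalize Real.exp (4 * ℓ) = Y at *
    have h4 : Y * (1 / 2) * ((4 + δ ℓ) ^ 2 * ((κ * X) ^ 2 * (2 * Real.cosh (4 * z) *
        (Y - X) + 16 * ℓ))) = (1 / 2) * (4 + δ ℓ) ^ 2 * (κ ^ 2 *
        (2 * Real.cosh (4 * z) + 4 * ((4 * ℓ) ^ 1 * X))) -
        (1 / 2) * (4 + δ ℓ) ^ 2 * (κ ^ 2 * (2 * Real.cosh (4 * z) * X ^ 2)) := by
      linear_combination ((4 + δ ℓ) ^ 2 * κ ^ 2 * (Real.cosh (4 * z) * (Y * X - X ^ 2 + 1) +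
        8 * ℓ * X)) * e
    rw [h4]
    have : 0 ≤ (1 / 2) * (4 + δ ℓ) ^ 2 * (κ ^ 2 * (2 * Real.cosh (4 * z) * X ^ 2)) := by
      positivity
    linarith

/-! ### The excess free energy in terms of defects -/

theorem IsMinimizer.exists_isSobolev {ℓ : ℝ} (hℓ : 0 < ℓ) {m : Profile} (hm : IsMinimizer ℓ m) :
    ∃ g, IsSobolev (-ℓ) ℓ m.1 g := by
  -- The recovery profile serves only as a competitor of finite energy.
  obtain ⟨B, δ, -, -, h⟩ := exists_recovery 0
  obtain ⟨x, hx, g, hg, -⟩ := h ℓ hℓ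
  have h1 := hm.2 x hx
  rw [freeEnergy_eq_defect hℓ hx hg] at h1
  exact (exists_isSobolev_of_freeEnergy_ne_top hℓ
    (ne_top_of_le_ne_top ENNReal.ofReal_ne_top h1)).2

theorem excessFreeEnergy_eq {ℓ : ℝ} (hℓ : 0 < ℓ) {m x : Profile} {k g : ℝ → ℝ}
    (hm : m ∈ boundarySet ℓ) (hk : IsSobolev (-ℓ) ℓ m.1 k)
    (hx : x ∈ boundarySet ℓ) (hg : IsSobolev (-ℓ) ℓ x.1 g) :
    excessFreeEnergy ℓ m x = ENNReal.ofReal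
      (Real.exp (4 * ℓ) * ((1 / 2) * defect (-ℓ) ℓ x.1 g) -
        Real.exp (4 * ℓ) * ((1 / 2) * defect (-ℓ) ℓ m.1 k)) := by
  have h0 := defect_nonneg (show -ℓ ≤ ℓ by linarith) m.1 k
  rw [excessFreeEnergy, freeEnergy_eq_defect hℓ hx hg, freeEnergy_eq_defect hℓ hm hk,
    ← ENNReal.ofReal_sub _ (by positivity), ← ENNReal.ofReal_mul (Real.exp_pos _).le]
  congr 1
  ring

/-- The minimal energy is finite, so infinite energy would force infinite excess. -/
theorem exists_isSobolev_of_excess_ne_top {ℓ : ℝ} (hℓ : 0 < ℓ) {m x : Profile}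
    (hm : IsMinimizer ℓ m) (h : excessFreeEnergy ℓ m x ≠ ⊤) :
    x ∈ boundarySet ℓ ∧ ∃ g, IsSobolev (-ℓ) ℓ x.1 g := by
  refine exists_isSobolev_of_freeEnergy_ne_top hℓ fun htop => h ?_
  obtain ⟨k, hk⟩ := hm.exists_isSobolev hℓ
  rw [excessFreeEnergy, htop, freeEnergy_eq_defect hℓ hm.1 hk,
    ENNReal.top_sub ENNReal.ofReal_ne_top, ENNReal.mul_top]
  exact (ENNReal.ofReal_pos.2 (Real.exp_pos _)).ne'

theorem IsMinimizer.defect_le {ℓ : ℝ} (hℓ : 0 < ℓ) {m x : Profile} {k g : ℝ → ℝ}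
    (hm : IsMinimizer ℓ m) (hk : IsSobolev (-ℓ) ℓ m.1 k)
    (hx : x ∈ boundarySet ℓ) (hg : IsSobolev (-ℓ) ℓ x.1 g) :
    defect (-ℓ) ℓ m.1 k ≤ defect (-ℓ) ℓ x.1 g := by
  have h := hm.2 x hx
  have h0 := defect_nonneg (show -ℓ ≤ ℓ by linarith) x.1 g
  rw [freeEnergy_eq_defect hℓ hx hg, freeEnergy_eq_defect hℓ hm.1 hk,
    ENNReal.ofReal_le_ofReal_iff (by positivity)] at h
  linarith

/-! ### Minimal cost, equi-coercivity and Γ-convergence -/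

section Sequences

variable {L : ℕ → ℝ} {m : ℕ → Profile} {k : ℕ → ℝ → ℝ}

/-- The asymptotics `4/3 + 16 exp (-4ℓ)` of the minimal free energy. -/
theorem tendsto_minimal_defect (hL0 : ∀ n, 0 < L n) (hL : Tendsto L atTop atTop)
    (hm : ∀ n, IsMinimizer (L n) (m n)) (hk : ∀ n, IsSobolev (-L n) (L n) (m n).1 (k n)) :
    Tendsto (fun n => Real.exp (4 * L n) * ((1 / 2) * defect (-L n) (L n) (m n).1 (k n)))
      atTop (𝓝 16) := by
  rw [tendsto_order]
  refine ⟨fun c hc => ?_, fun c hc => ?_⟩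
  -- Otherwise a subsequence of minimizers has cost at most `c < 16`, and compactness yields `z`
  -- with `16 cosh(4z) ≤ c`.
  · by_contra hcon
    obtain ⟨φ, hφ, h⟩ := extraction_of_frequently_atTop (not_eventually.1 hcon)
    obtain ⟨z, -, -, -, -, -, hz⟩ := exists_subseq_tendsto (fun j => hL0 (φ j))
      (hL.comp hφ.tendsto_atTop) (fun j => (hm (φ j)).1) (fun j => hk (φ j))
      (B := fun _ => c) (fun j => not_lt.1 (h j)) tendsto_const_nhds
    linarith [Real.one_le_cosh (4 * z)]
  -- The recovery profile centred at `0` is a competitor whose cost tends to at most `16`.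
  · obtain ⟨B, δ, hB, -, h⟩ := exists_recovery 0
    rw [mul_zero, Real.cosh_zero, mul_one] at hB
    filter_upwards [(hB.comp hL).eventually (gt_mem_nhds hc)] with n hn
    obtain ⟨x, hx, g, hg, -, hxB⟩ := h (L n) (hL0 n)
    refine lt_of_le_of_lt ?_ (hxB.trans_lt hn)
    have := (hm n).defect_le (hL0 n) (hk n) hx hg
    gcongr

/-- The total cost is at most `c` plus the minimal cost, which tends to `16`; the compactness bound
`16 cosh(4z) ≤ c + 16` is the claim. -/
theorem exists_subseq_of_excess_le (hL0 : ∀ n, 0 < L n) (hL : Tendsto L atTop atTop)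
    (hm : ∀ n, IsMinimizer (L n) (m n)) {x : ℕ → Profile} {c : ℝ} (hc : 0 ≤ c)
    (h : ∀ n, excessFreeEnergy (L n) (m n) (x n) ≤ ENNReal.ofReal c) :
    ∃ (z : ℝ) (a : Profile) (φ : ℕ → ℕ), IsTranslate z a ∧ StrictMono φ ∧
      Tendsto (fun j => x (φ j)) atTop (𝓝 a) ∧ 16 * (Real.cosh (4 * z) - 1) ≤ c := by
  have hx := fun n => exists_isSobolev_of_excess_ne_top (hL0 n) (hm n)
    (ne_top_of_le_ne_top ENNReal.ofReal_ne_top (h n))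
  choose hxb g hg using hx
  choose k hk using fun n => (hm n).exists_isSobolev (hL0 n)
  obtain ⟨z, a, φ, h1, h2, h3, h4⟩ := exists_subseq_tendsto hL0 hL hxb hg
    (B := fun n => c + Real.exp (4 * L n) * ((1 / 2) * defect (-L n) (L n) (m n).1 (k n)))
    (fun n => by
      have h5 := h n
      rw [excessFreeEnergy_eq (hL0 n) (hm n).1 (hk n) (hxb n) (hg n),
        ENNReal.ofReal_le_ofReal_iff hc] at h5
      linarith)
    ((tendsto_minimal_defect hL0 hL hm hk).const_add c)
  exact ⟨z, a, φ, h1, h2, h3, by linarith⟩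

/-- The common core of the two conclusions: equi-coercivity uses the convergence, the `liminf`
inequality also the bound on the limit. -/
theorem exists_subseq_of_frequently_excess_lt (hL0 : ∀ n, 0 < L n) (hL : Tendsto L atTop atTop)
    (hm : ∀ n, IsMinimizer (L n) (m n)) {x : ℕ → Profile} {c : ℝ≥0∞} (hc : c ≠ ⊤)
    (h : ∃ᶠ n in atTop, excessFreeEnergy (L n) (m n) (x n) < c) :
    ∃ (a : Profile) (φ : ℕ → ℕ), StrictMono φ ∧
      Tendsto (fun j => x (φ j)) atTop (𝓝 a) ∧ limitFunctional a ≤ c := by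
  obtain ⟨φ, hφ, hlt⟩ := extraction_of_frequently_atTop h
  obtain ⟨z, a, ψ, h1, h2, h3, h4⟩ := exists_subseq_of_excess_le (fun j => hL0 (φ j))
    (hL.comp hφ.tendsto_atTop) (fun j => hm (φ j)) (x := fun j => x (φ j))
    (c := c.toReal) ENNReal.toReal_nonneg (fun j => by
      rw [ENNReal.ofReal_toReal hc]
      exact (hlt j).le)
  refine ⟨a, φ ∘ ψ, hφ.comp h2, h3, ?_⟩
  rw [limitFunctional_eq h1, ← ENNReal.ofReal_toReal hc]
  exact ENNReal.ofReal_le_ofReal h4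

theorem equiCoercive_excess (hL0 : ∀ n, 0 < L n) (hL : Tendsto L atTop atTop)
    (hm : ∀ n, IsMinimizer (L n) (m n)) :
    EquiCoercive fun n => excessFreeEnergy (L n) (m n) := by
  intro x hx
  obtain ⟨c, hc1, hc2⟩ := exists_between hx
  obtain ⟨a, φ, h1, h2, -⟩ := exists_subseq_of_frequently_excess_lt hL0 hL hm hc2.ne
    (eventually_lt_of_limsup_lt hc1).frequently
  exact ⟨a, φ, h1, h2⟩

theorem exists_recovery_sequence (hL0 : ∀ n, 0 < L n) (hL : Tendsto L atTop atTop)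
    (hm : ∀ n, IsMinimizer (L n) (m n)) (a : Profile) :
    ∃ x : ℕ → Profile, Tendsto x atTop (𝓝 a) ∧
      limsup (fun n => excessFreeEnergy (L n) (m n) (x n)) atTop ≤ limitFunctional a := by
  by_cases ha : ∃ z, IsTranslate z a
  · obtain ⟨z, hz⟩ := ha
    obtain ⟨B, δ, hB, hδ, h⟩ := exists_recovery z
    choose x hxb g hg hxδ hxB using fun n => h (L n) (hL0 n)
    choose k hk using fun n => (hm n).exists_isSobolev (hL0 n)
    refine ⟨x, tendsto_of_abs_sub_le (hδ.comp hL) (Eventually.of_forall fun n t => ?_), ?_⟩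
    · rw [hz t]
      exact hxδ n t
    · have hlim := ENNReal.tendsto_ofReal ((hB.comp hL).sub (tendsto_minimal_defect hL0 hL hm hk))
      rw [limitFunctional_eq hz, mul_sub, mul_one, ← hlim.limsup_eq]
      refine limsup_le_limsup (Eventually.of_forall fun n => ?_)
      beta_reduce
      rw [excessFreeEnergy_eq (hL0 n) (hm n).1 (hk n) (hxb n) (hg n)]
      exact ENNReal.ofReal_le_ofReal (sub_le_sub_right (hxB n) _)
  · refine ⟨fun _ => a, tendsto_const_nhds, ?_⟩
    rw [limitFunctional, dif_neg ha]
    exact le_top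

theorem gammaConverges_excess (hL0 : ∀ n, 0 < L n) (hL : Tendsto L atTop atTop)
    (hm : ∀ n, IsMinimizer (L n) (m n)) :
    GammaConverges (fun n => excessFreeEnergy (L n) (m n)) limitFunctional := by
  refine fun a => ⟨exists_recovery_sequence hL0 hL hm a, fun x hx => ?_⟩
  by_contra hcon
  -- A level `c` strictly between the `liminf` and the limiting value is undercut infinitely often;
  -- the resulting subsequential limit must be `a`, so its limiting value is at most `c`.
  obtain ⟨c, hc1, hc2⟩ := exists_between (not_le.1 hcon)
  obtain ⟨a', φ, h1, h2, h3⟩ := exists_subseq_of_frequently_excess_lt hL0 hL hm hc2.ne_top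
    (frequently_lt_of_liminf_lt (by isBoundedDefault) hc1)
  rw [tendsto_nhds_unique h2 (hx.comp h1.tendsto_atTop)] at h3
  exact absurd hc2 (not_lt.2 h3)

end Sequences

end DoubleWell

theorem theorem2p2 :
    (∀ ℓ : ℝ, 0 < ℓ → ∃! m : DoubleWell.Profile, DoubleWell.IsMinimizer ℓ m) ∧
    ∀ m : ℝ → DoubleWell.Profile, (∀ ℓ : ℝ, 0 < ℓ → DoubleWell.IsMinimizer ℓ (m ℓ)) →
      ∀ L : ℕ → ℝ, (∀ n, 0 < L n) → Filter.Tendsto L Filter.atTop Filter.atTop →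
        DoubleWell.EquiCoercive (fun n => DoubleWell.excessFreeEnergy (L n) (m (L n))) ∧
        DoubleWell.GammaConverges (fun n => DoubleWell.excessFreeEnergy (L n) (m (L n)))
          DoubleWell.limitFunctional := by
  refine ⟨fun ℓ hℓ => DoubleWell.existsUnique_isMinimizer hℓ, fun m hm L hL0 hL => ?_⟩
  exact ⟨DoubleWell.equiCoercive_excess hL0 hL fun n => hm (L n) (hL0 n),
    DoubleWell.gammaConverges_excess hL0 hL fun n => hm (L n) (hL0 n)⟩
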